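/- Let $\widehat{\mathbb C}=\mathbb C\cup\{\infty\}$ be the Riemann sphere and let $\sigma(z,w)=\inf_\gamma\int_\gamma \frac{2\,|d\zeta|}{1+|\zeta|^2}$ be its spherical metric, the infimum being over all rectifiable paths $\gamma$ in $\widehat{\mathbb C}$ from $z$ to $w$. For a domain (nonempty connected open set) $\Omega\subset\widehat{\mathbb C}$ with $\partial\Omega\neq\emptyset$, the spherical quasihyperbolic metric of $\Omega$ is $$k_\Omega(x,y)=\inf_\gamma\int_\gamma \frac{1}{\operatorname{dist}_\sigma(\zeta,\partial\Omega)}\,\frac{2\,|d\zeta|}{1+|\zeta|^2},\qquad x,y\in\Omega,$$ the infimum being over all rectifiable paths $\gamma$ in $\Omega$ from $x$ to $y$. For $\delta>0$, the domain $\Omega$ is called $\delta$-hyperbolic if $(\Omega,k_\Omega)$ is a geodesic metric space in which each side of every geodesic triangle lies within distance $\delta$ of the union of the other two sides. A conformal map $f\colon U\to V$ is a holomorphic bijection of $U$ onto $V$. **Theorem.** Let $a>0$. 1. There is a constant $L=L(a)\ge 1$, depending only on $a$, such that for all domains $U,V\subset\widehat{\mathbb C}$ with $\operatorname{diam}_\sigma(\widehat{\mathbb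 C}\setminus U)\ge a$ and $\operatorname{diam}_\sigma(\widehat{\mathbb C}\setminus V)\ge a$ and every conformal map $f\colon U\to V$, $$L^{-1}k_U(x,y)\le k_V(f(x),f(y))\le L\,k_U(x,y)\qquad\text{for all }x,y\in U.$$ 2. For every $\delta>0$ there is $\delta'=\delta'(a,\delta)>0$, depending only on $a$ and $\delta$, such that for all domains $U,V\subset\widehat{\mathbb C}$ with $\operatorname{diam}_\sigma(\widehat{\mathbb C}\setminus U)\ge a$ and $\operatorname{diam}_\sigma(\widehat{\mathbb C}\setminus V)\ge a$ for which there is a conformal map $f\colon U\to V$, if $U$ is $\delta$-hyperbolic, then $V$ is $\delta'$-hyperbolic. -/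

import Mathlib

open Set Filter Topology MeasureTheory OnePoint
open scoped ENNReal

noncomputable section

namespace SphericalQH

/-- The Riemann sphere, with the topology of the one-point compactification of the plane. -/
abbrev CHat : Type := OnePoint ℂ

/-- The coordinate `z` on the sphere minus the point at infinity (the value at `∞` is junk). -/
def finiteCoord (q : CHat) : ℂ := q.elim 0 (fun z => z)

/-- The coordinate `1/z` on the sphere minus the origin, with value `0` at `∞`
(the value at the origin is junk). -/
def inftyCoord (q : CHat) : ℂ := q.elim 0 (fun z => z⁻¹)

/-- A holomorphic coordinate near `p`: it is `z` if `p` is finite and `1/z` if `p = ∞`. -/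
def coordAt (p : CHat) : CHat → ℂ := p.elim inftyCoord (fun _ => finiteCoord)

/-- The local parametrization of the sphere inverse to `coordAt p`. -/
def paramAt (p : CHat) : ℂ → CHat :=
  open scoped Classical in
  p.elim (fun w => if w = 0 then (∞ : CHat) else ((w⁻¹ : ℂ) : CHat)) (fun _ z => (z : CHat))

/-- The chordal metric on the sphere. -/
def chordal (p q : CHat) : ℝ :=
  p.elim
    (q.elim 0 (fun w => 2 / √(1 + ‖w‖ ^ 2)))
    (fun z => q.elim (2 / √(1 + ‖z‖ ^ 2))
      (fun w => 2 * ‖z - w‖ / (√(1 + ‖z‖ ^ 2) * √(1 + ‖w‖ ^ 2))))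

/-- A rectifiable path in `Ω` from `x` to `y`, in a Lipschitz parametrization by `[0,1]`.
Lipschitz paths have finite length, and every path of finite length has such a parametrization
(proportional to arc length); integrals with respect to arc length do not depend on the
parametrization.  The values of `γ` outside `[0,1]` play no role. -/
def IsRectifiablePath (Ω : Set CHat) (x y : CHat) (γ : ℝ → CHat) : Prop :=
  γ 0 = x ∧ γ 1 = y ∧ (∀ t ∈ Icc (0 : ℝ) 1, γ t ∈ Ω) ∧
    ∃ K : ℝ, ∀ s ∈ Icc (0 : ℝ) 1, ∀ t ∈ Icc (0 : ℝ) 1, chordal (γ s) (γ t) ≤ K * |s - t|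

/-- The speed of `γ` at time `t` for the spherical length element `2 |dz| / (1 + |z|²)`.
This length element has the same expression in the coordinate `1/z`, which is used at `∞`. -/
def sphericalSpeed (γ : ℝ → CHat) (t : ℝ) : ℝ :=
  2 * ‖deriv (fun s => coordAt (γ t) (γ s)) t‖ / (1 + ‖coordAt (γ t) (γ t)‖ ^ 2)

/-- The integral of the density `ρ` along `γ` with respect to spherical arc length
`2 |dz| / (1 + |z|²)`. -/
def lineIntegral (ρ : CHat → ℝ≥0∞) (γ : ℝ → CHat) : ℝ≥0∞ :=
  ∫⁻ t in Icc (0 : ℝ) 1, ρ (γ t) * ENNReal.ofReal (sphericalSpeed γ t)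

/-- The infimum of the `ρ`-lengths of the rectifiable paths in `Ω` from `x` to `y`. -/
def pathInf (Ω : Set CHat) (ρ : CHat → ℝ≥0∞) (x y : CHat) : ℝ≥0∞ :=
  ⨅ (γ : ℝ → CHat) (_ : IsRectifiablePath Ω x y γ), lineIntegral ρ γ

/-- The spherical metric `σ`. -/
def sphericalDist (z w : CHat) : ℝ≥0∞ := pathInf univ (fun _ => 1) z w

/-- The spherical diameter of a set. -/
def sphericalDiam (E : Set CHat) : ℝ≥0∞ := ⨆ z ∈ E, ⨆ w ∈ E, sphericalDist z w

/-- The spherical distance from a point to a set. -/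
def sphericalInfDist (z : CHat) (E : Set CHat) : ℝ≥0∞ := ⨅ w ∈ E, sphericalDist z w

/-- The spherical quasihyperbolic metric of `Ω`, as an infimum in `[0,∞]`. -/
def qhEDist (Ω : Set CHat) (x y : CHat) : ℝ≥0∞ :=
  pathInf Ω (fun z => (sphericalInfDist z (frontier Ω))⁻¹) x y

/-- The spherical quasihyperbolic metric of `Ω`, as a real number. -/
def qhDist (Ω : Set CHat) (x y : CHat) : ℝ := (qhEDist Ω x y).toReal

/-- Domains: nonempty connected open subsets of the sphere. -/
def IsDomainOfSphere (Ω : Set CHat) : Prop := IsOpen Ω ∧ IsConnected Ω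

/-- Holomorphy at a point of a map between open subsets of the sphere: continuity, and complex
differentiability in the coordinates `z` and `1/z` (to be required at all points of an open set). -/
def HolomorphicAt (f : CHat → CHat) (p : CHat) : Prop :=
  ContinuousAt f p ∧
    DifferentiableAt ℂ (fun w => coordAt (f p) (f (paramAt p w))) (coordAt p p)

/-- `f` restricts to a conformal map from `U` onto `V`: a holomorphic bijection of the open set
`U` onto `V`. -/
def IsConformalMap (f : CHat → CHat) (U V : Set CHat) : Prop :=
  BijOn f U V ∧ ∀ p ∈ U, HolomorphicAt f p

/-- `f` is `L`-bi-Lipschitz on `S` with respect to the distances `dX` and `dY`. -/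
def IsBiLipschitzOn {X Y : Type*} (L : ℝ) (dX : X → X → ℝ) (dY : Y → Y → ℝ)
    (f : X → Y) (S : Set X) : Prop :=
  ∀ x ∈ S, ∀ y ∈ S, L⁻¹ * dX x y ≤ dY (f x) (f y) ∧ dY (f x) (f y) ≤ L * dX x y

/-- `S` is (the image of) a geodesic from `x` to `y` in the space `X` with distance `d`. -/
def IsGeodesicSegment {X : Type*} (d : X → X → ℝ) (x y : X) (S : Set X) : Prop :=
  ∃ γ : ℝ → X, γ 0 = x ∧ γ (d x y) = y ∧
    (∀ s ∈ Icc 0 (d x y), ∀ t ∈ Icc 0 (d x y), d (γ s) (γ t) = |s - t|) ∧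
    S = γ '' Icc 0 (d x y)

/-- The space `X` with distance `d` is geodesic and all its geodesic triangles are `δ`-thin: each
side is within distance `δ` from the union of the two others.  (By relabelling the vertices it is
enough to name the side from `x` to `y`.) -/
def IsDeltaHyperbolic {X : Type*} (d : X → X → ℝ) (δ : ℝ) : Prop :=
  (∀ x y : X, ∃ S, IsGeodesicSegment d x y S) ∧
    ∀ (x y z : X) (A B C : Set X), IsGeodesicSegment d x y A → IsGeodesicSegment d y z B →
      IsGeodesicSegment d z x C → ∀ p ∈ A, ∃ q ∈ B ∪ C, d p q ≤ δ

/-- A domain of the sphere is `δ`-hyperbolic if it is so in its spherical quasihyperbolic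
metric. -/
def IsHyperbolicDomain (Ω : Set CHat) (δ : ℝ) : Prop :=
  IsDeltaHyperbolic (fun x y : Ω => qhDist Ω x y) δ

end SphericalQH

end

noncomputable section

namespace SphericalQH

/-! Part 1 is infinitesimal. Write d(z) for the chordal distance from z to the boundary of the
domain in question. The claim to prove is that the spherical dilatation of a conformal map f at z is
at most C d(f z) / d(z), with C depending only on a. Integrated along paths, this says that f is
Lipschitz for the quasihyperbolic metrics; the same bound for the inverse of f gives the other
inequality.

The dilatation bound is a Koebe estimate (`koebe_weak`): a univalent function on a disc of radius R
cannot omit a value much closer to the image of the centre than R times its derivative there. To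
apply it on the sphere, choose e outside U and e' outside V and use coordinates with poles at e and
e'. In them f is a univalent function between plane domains, and `norm_chart_sub` converts plane
distances exactly into chordal ones. The conversion factors are harmless once e is far from z and e'
is far from the boundary point nearest to f z. The diameter hypothesis on the complements provides
such poles (`exists_far_mem`), and the result is `eventually_chordal_map_le`. Chordal and spherical
distances agree up to the factor 16, so chordal distances serve throughout.

Part 2 combines Part 1 with two facts. The quasihyperbolic metric is geodesic (`exists_geodesic`):
almost minimizing paths have a pointwise limit, by compactness of the sphere, and the limit stays in
the domain because log d is Lipschitz for the quasihyperbolic metric. And in a hyperbolic space a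
bi-Lipschitz path stays uniformly close to a geodesic with the same endpoints
(`exists_morse_constant`). Hence a geodesic triangle of V, carried to U, is close to a thin
triangle, and is thin itself. -/

/-! ### Univalent functions in the plane: holomorphic inverses and a Koebe estimate -/

/-- A nonvanishing holomorphic function on a disc has a holomorphic square root. -/
theorem exists_sqrt_on_ball {f : ℂ → ℂ} {c : ℂ} {R : ℝ}
    (hf : DifferentiableOn ℂ f (Metric.ball c R)) (h0 : ∀ z ∈ Metric.ball c R, f z ≠ 0)
    (hc : f c = 1) (hR : 0 < R) :
    ∃ h : ℂ → ℂ, h c = 1 ∧ DifferentiableOn ℂ h (Metric.ball c R) ∧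
      ∀ z ∈ Metric.ball c R, h z ^ 2 = f z := by
  have hd : DifferentiableOn ℂ (fun z => deriv f z / f z) (Metric.ball c R) :=
    (hf.deriv Metric.isOpen_ball).div hf h0
  obtain ⟨φ, hφc, hφ⟩ := hd.isExactOn_ball.with_val_at c 0
  have hu : ∀ z ∈ Metric.ball c R, HasDerivAt (fun z => f z * Complex.exp (-φ z)) 0 z := by
    intro z hz
    have h1 := (hf.differentiableAt (Metric.isOpen_ball.mem_nhds hz)).hasDerivAt
    have h2 := h1.mul ((hφ z hz).neg.cexp)
    refine h2.congr_deriv ?_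
    have e := mul_div_cancel₀ (deriv f z) (h0 z hz)
    linear_combination -Complex.exp (-φ z) * e
  have hconst : ∀ z ∈ Metric.ball c R, f z * Complex.exp (-φ z) = 1 := by
    intro z hz
    have h1 := (convex_ball c R).is_const_of_fderivWithin_eq_zero (𝕜 := ℂ)
      (f := fun z => f z * Complex.exp (-φ z))
      (fun x hx => (hu x hx).differentiableAt.differentiableWithinAt) (fun x hx => by
        rw [fderivWithin_of_isOpen Metric.isOpen_ball hx]
        ext
        simpa using (hu x hx).deriv) hz (Metric.mem_ball_self hR)
    simpa [hφc, hc] using h1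
  refine ⟨fun z => Complex.exp (φ z / 2), by simp [hφc], fun z hz => ?_, fun z hz => ?_⟩
  · exact ((hφ z hz).differentiableAt.div_const 2).cexp.differentiableWithinAt
  · have h1 := hconst z hz
    rw [Complex.exp_neg] at h1
    have h2 : f z = Complex.exp (φ z) := by
      field_simp [Complex.exp_ne_zero] at h1
      exact h1
    rw [h2, ← Complex.exp_nat_mul]
    congr 1
    push_cast
    ring

theorem nhds_le_map_nhds_of_injOn {F : ℂ → ℂ} {W : Set ℂ} (hW : IsOpen W)
    (hF : DifferentiableOn ℂ F W) (hinj : InjOn F W) {w : ℂ} (hw : w ∈ W) :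
    𝓝 (F w) ≤ map F (𝓝 w) := by
  have ha : AnalyticAt ℂ F w := hF.analyticAt (hW.mem_nhds hw)
  refine ha.eventually_constant_or_nhds_le_map_nhds.resolve_left fun h => ?_
  have h1 : ∀ᶠ z in 𝓝[≠] w, F z = F w ∧ z ∈ W ∧ z ≠ w := by
    filter_upwards [h.filter_mono nhdsWithin_le_nhds, mem_nhdsWithin_of_mem_nhds (hW.mem_nhds hw),
      self_mem_nhdsWithin] with z h1 h2 h3 using ⟨h1, h2, h3⟩
  obtain ⟨z, hz1, hz2, hz3⟩ := h1.exists
  exact hz3 (hinj hz2 hw hz1)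

theorem isOpen_image_of_injOn {F : ℂ → ℂ} {W : Set ℂ} (hW : IsOpen W)
    (hF : DifferentiableOn ℂ F W) (hinj : InjOn F W) : IsOpen (F '' W) := by
  rw [isOpen_iff_mem_nhds]
  rintro _ ⟨w, hw, rfl⟩
  exact nhds_le_map_nhds_of_injOn hW hF hinj hw (image_mem_map (hW.mem_nhds hw))

theorem continuousAt_of_leftInverse {F G : ℂ → ℂ} {W : Set ℂ} (hW : IsOpen W)
    (hF : DifferentiableOn ℂ F W) (hinj : InjOn F W) (hG : ∀ z ∈ W, G (F z) = z) {w : ℂ}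
    (hw : w ∈ W) : ContinuousAt G (F w) := by
  have h2 : Tendsto G (map F (𝓝 w)) (𝓝 w) := by
    rw [tendsto_map'_iff]
    refine tendsto_id.congr' ?_
    filter_upwards [hW.mem_nhds hw] with z hz using (hG z hz).symm
  simpa [ContinuousAt, hG w hw] using h2.mono_left (nhds_le_map_nhds_of_injOn hW hF hinj hw)

/-- The inverse of an injective holomorphic function is holomorphic. -/
theorem differentiableAt_of_leftInverse {F G : ℂ → ℂ} {W : Set ℂ} (hW : IsOpen W)
    (hF : DifferentiableOn ℂ F W) (hinj : InjOn F W) (hG : ∀ z ∈ W, G (F z) = z) {w : ℂ}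
    (hw : w ∈ W) : DifferentiableAt ℂ G (F w) := by
  have hGc : ∀ z ∈ W, ContinuousAt G (F z) := fun z hz =>
    continuousAt_of_leftInverse hW hF hinj hG hz
  have hFG : ∀ z ∈ W, ∀ᶠ y in 𝓝 (F z), F (G y) = y := fun z hz => by
    filter_upwards [(isOpen_image_of_injOn hW hF hinj).mem_nhds (mem_image_of_mem F hz)]
    rintro _ ⟨x, hx, rfl⟩
    rw [hG x hx]
  have hreg : ∀ z ∈ W, deriv F z ≠ 0 → DifferentiableAt ℂ G (F z) := fun z hz h => by
    have h1 : HasStrictDerivAt F (deriv F z) (G (F z)) := by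
      rw [hG z hz]
      exact (hF.analyticAt (hW.mem_nhds hz)).hasStrictDerivAt
    exact (HasStrictDerivAt.of_local_left_inverse (hGc z hz) h1 h (hFG z hz)).hasDerivAt.differentiableAt
  -- It need not be known that F' is zero-free. Its zeros are isolated, since F is not locally
  -- constant; G is holomorphic at the images of the other points by the inverse function theorem,
  -- and being continuous it extends holomorphically over the exceptional value.
  have hd : AnalyticAt ℂ (deriv F) w := (hF.analyticAt (hW.mem_nhds hw)).deriv
  rcases hd.eventually_eq_zero_or_eventually_ne_zero with h | h
  · exfalso
    obtain ⟨r, hr, hball⟩ := Metric.eventually_nhds_iff_ball.1 (h.and (hW.mem_nhds hw))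
    have hc : ∀ z ∈ Metric.ball w r, F z = F w := fun z hz =>
      (convex_ball w r).is_const_of_fderivWithin_eq_zero (𝕜 := ℂ)
        (fun x hx => (hF x (hball x hx).2).mono fun y hy => (hball y hy).2) (fun x hx => by
          rw [fderivWithin_of_isOpen Metric.isOpen_ball hx]
          ext
          simpa using (hball x hx).1) hz (Metric.mem_ball_self hr)
    have h1 : w + (r / 2 : ℝ) ∈ Metric.ball w r := by
      simp [abs_of_pos hr, hr]
    have h2 := hinj (hball _ h1).2 hw (hc _ h1)
    simp [hr.ne'] at h2
  · refine (Complex.analyticAt_of_differentiable_on_punctured_nhds_of_continuousAt ?_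
      (hGc w hw)).differentiableAt
    have h1 : ∀ᶠ z in 𝓝 w, z ≠ w → deriv F z ≠ 0 ∧ z ∈ W := by
      filter_upwards [eventually_nhdsWithin_iff.1 h, hW.mem_nhds hw] with z h1 h2 h3 using ⟨h1 h3, h2⟩
    have hGt : Tendsto G (𝓝 (F w)) (𝓝 w) := by simpa [ContinuousAt, hG w hw] using hGc w hw
    rw [eventually_nhdsWithin_iff]
    filter_upwards [hGt.eventually h1, hFG w hw] with y hy hy2 hyw
    have hne : G y ≠ w := fun hh => hyw (by rw [← hy2, hh]; rfl)
    have := hreg _ (hy hne).2 (hy hne).1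
    rwa [hy2] at this

/-- A weak form of the Koebe one-quarter theorem. -/
theorem koebe_weak {F : ℂ → ℂ} {c p : ℂ} {R : ℝ} (hR : 0 < R)
    (hF : DifferentiableOn ℂ F (Metric.ball c R)) (hinj : InjOn F (Metric.ball c R))
    (hp : p ∉ F '' Metric.ball c R) : R * ‖deriv F c‖ ≤ 24 * ‖p - F c‖ := by
  have hcB := Metric.mem_ball_self (x := c) hR
  -- With p replaced by the nearest omitted value w, the disc about F c of radius |w - F c| lies in
  -- the image. Over that disc the branch of the square root can be identified.
  obtain ⟨w, hw, hwmin⟩ := (isOpen_image_of_injOn Metric.isOpen_ball hF hinj).isClosed_compl.exists_infDist_eq_dist ⟨p, hp⟩ (F c)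
  have hwp : dist (F c) w ≤ ‖p - F c‖ := by
    rw [← hwmin, ← dist_eq_norm, dist_comm p]
    exact Metric.infDist_le_dist_of_mem hp
  refine le_trans ?_ (mul_le_mul_of_nonneg_left hwp (by norm_num))
  set u : ℂ := w - F c with hu
  have hu0 : u ≠ 0 := fun h => hw ⟨c, hcB, (sub_eq_zero.1 h).symm⟩
  have hdu : dist (F c) w = ‖u‖ := by rw [dist_comm, dist_eq_norm]
  rw [hdu]
  have hsub : Metric.ball (F c) ‖u‖ ⊆ F '' Metric.ball c R := by
    intro y hy
    by_contra hy2
    have := Metric.infDist_le_dist_of_mem (x := F c) (s := (F '' Metric.ball c R)ᶜ) hy2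
    rw [hwmin, hdu] at this
    rw [Metric.mem_ball, dist_comm] at hy
    linarith
  obtain ⟨h, hhc, hhd, hh2⟩ := exists_sqrt_on_ball (f := fun z => 1 - (F z - F c) / u) (c := c) (R := R)
    ((differentiableOn_const _).sub ((hF.sub_const _).div_const _)) (fun z hz h0 => hw ⟨z, hz, by
      rw [sub_eq_zero, eq_comm, div_eq_one_iff_eq hu0, hu] at h0
      linear_combination h0⟩) (by simp) hR
  -- the branch of the square root over the disc is the principal one
  have hre : ∀ z ∈ Metric.ball c R, ‖F z - F c‖ < ‖u‖ → 0 < (h z).re := by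
    set G := Function.invFunOn F (Metric.ball c R)
    have hG : ∀ z ∈ Metric.ball c R, G (F z) = z := fun z hz => hinj.leftInvOn_invFunOn hz
    have hcont : ContinuousOn (fun y => (h (G y)).re) (Metric.ball (F c) ‖u‖) := by
      intro y hy
      obtain ⟨z, hz, rfl⟩ := hsub hy
      have h1 := continuousAt_of_leftInverse Metric.isOpen_ball hF hinj hG hz
      have h2 : ContinuousAt h (G (F z)) := by
        rw [hG z hz]
        exact (hhd.differentiableAt (Metric.isOpen_ball.mem_nhds hz)).continuousAt
      exact (Complex.continuous_re.continuousAt.comp (ContinuousAt.comp h2 h1)).continuousWithinAt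
    intro z hz hlt
    by_contra hneg
    push Not at hneg
    have hpre := ((convex_ball (F c) ‖u‖).isPreconnected.image _ hcont).ordConnected
    have h0 : (0 : ℝ) ∈ (fun y => (h (G y)).re) '' Metric.ball (F c) ‖u‖ := by
      refine hpre.out (x := (h z).re) (y := 1) ⟨F z, by simpa [dist_eq_norm] using hlt, by simp [hG z hz]⟩
        ⟨F c, by simpa using hu0, by simp [hG c hcB, hhc]⟩ ⟨hneg, zero_le_one⟩
    obtain ⟨y, hy, hy0⟩ := h0
    obtain ⟨x, hx, rfl⟩ := hsub hy
    simp only [hG x hx] at hy0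
    have h3 : ((h x) ^ 2).re ≤ 0 := by
      rw [sq, Complex.mul_re, hy0]
      nlinarith [sq_nonneg (h x).im]
    rw [hh2 x hx] at h3
    have h4 : ‖(F x - F c) / u‖ < 1 := by
      rw [norm_div, div_lt_one (norm_pos_iff.2 hu0)]
      simpa [dist_eq_norm] using hy
    have h5 := (Complex.re_le_norm ((F x - F c) / u)).trans_lt h4
    simp only [Complex.sub_re, Complex.one_re] at h3
    linarith
  -- If |h + 1| < 2/5, then |1 - h²| ≤ |h + 1| (2 + |h + 1|) < 0.96, so F z lies in the disc where
  -- Re h > 0, which is incompatible with h being near -1.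
  have homit : ∀ z ∈ Metric.ball c R, (2 / 5 : ℝ) ≤ ‖h z + 1‖ := by
    intro z hz
    by_contra hlt
    push Not at hlt
    have h1 : ‖(F z - F c) / u‖ < 1 := by
      have h2 : (F z - F c) / u = (h z + 1) * (2 - (h z + 1)) := by
        have := hh2 z hz
        linear_combination this
      rw [h2, norm_mul]
      have h3 : ‖2 - (h z + 1)‖ ≤ 2 + ‖h z + 1‖ := (norm_sub_le _ _).trans (by simp)
      nlinarith [norm_nonneg (h z + 1)]
    rw [norm_div, div_lt_one (norm_pos_iff.2 hu0)] at h1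
    have h2 := hre z hz h1
    have h3 := (Complex.re_le_norm (h z + 1))
    simp only [Complex.add_re, Complex.one_re] at h3
    linarith
  have hne : ∀ z ∈ Metric.ball c R, h z + 1 ≠ 0 := fun z hz h0 => by
    have := homit z hz
    rw [h0] at this
    norm_num at this
  -- The function 1/(h + 1) has modulus at most 5/2 and equals 1/2 at the centre, hence the radius
  -- 3. Its derivative at c is F'(c)/(8u), and 3 · 8 = 24 is the final constant.
  have hmaps : MapsTo (fun z => (h z + 1)⁻¹) (Metric.ball c R)
      (Metric.closedBall ((fun z => (h z + 1)⁻¹) c) 3) := by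
    intro z hz
    simp only [Metric.mem_closedBall, dist_eq_norm, hhc]
    have e1 : ‖(h z + 1)⁻¹‖ ≤ 5 / 2 := by
      rw [norm_inv, inv_le_comm₀ (by linarith [homit z hz]) (by norm_num)]
      linarith [homit z hz]
    have e2 : ‖((1 : ℂ) + 1)⁻¹‖ = 1 / 2 := by norm_num
    linarith [norm_sub_le (h z + 1)⁻¹ ((1 : ℂ) + 1)⁻¹]
  have hk : ‖deriv (fun z => (h z + 1)⁻¹) c‖ ≤ 3 / R := Complex.norm_deriv_le_div_of_mapsTo_ball ((hhd.add_const 1).inv hne) hmaps hR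
  have hnc : Metric.ball c R ∈ 𝓝 c := Metric.ball_mem_nhds c hR
  have hdc : HasDerivAt h (deriv h c) c := (hhd.differentiableAt hnc).hasDerivAt
  have hFc : HasDerivAt F (deriv F c) c := (hF.differentiableAt hnc).hasDerivAt
  have e1 : 2 * deriv h c = -(deriv F c / u) := by
    have h1 : HasDerivAt (fun z => h z ^ 2) (-(deriv F c / u)) c :=
      (((hFc.sub_const (F c)).div_const u).const_sub 1).congr_of_eventuallyEq
        (by filter_upwards [hnc] with z hz using hh2 z hz)
    simpa [hhc] using (hdc.pow 2).unique h1
  have e2 : deriv (fun z => (h z + 1)⁻¹) c = deriv F c / (8 * u) := by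
    have h1 : deriv (fun z => (h z + 1)⁻¹) c = -deriv h c / (h c + 1) ^ 2 :=
      ((hdc.add_const 1).inv (hne c hcB)).deriv
    rw [h1, hhc]
    have : deriv h c = -(deriv F c / u) / 2 := by linear_combination e1 / 2
    rw [this]
    field_simp
    ring
  rw [e2, norm_div, norm_mul] at hk
  have hu1 := norm_pos_iff.2 hu0
  rw [div_le_div_iff₀ (by simpa using hu0) hR] at hk
  norm_num at hk
  linarith

/-! ### The chordal metric and the coordinates with an arbitrary pole -/

/-- Stereographic projection, onto the unit sphere of `ℂ × ℝ`. -/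
def stereo (p : CHat) : WithLp 2 (ℂ × ℝ) :=
  p.elim (WithLp.toLp 2 (0, 1))
    (fun z => WithLp.toLp 2 (((2 / (1 + ‖z‖ ^ 2) : ℝ) : ℂ) * z, 1 - 2 / (1 + ‖z‖ ^ 2)))

theorem one_add_norm_sq_pos (z : ℂ) : 0 < 1 + ‖z‖ ^ 2 := by positivity

/-- The isometric embedding into Euclidean space supplies the metric axioms, compatibility with the
topology and, later, almost everywhere differentiability of Lipschitz paths. -/
theorem chordal_eq_dist (p q : CHat) : chordal p q = dist (stereo p) (stereo q) := by
  have key : ∀ w : ℂ, 2 / √(1 + ‖w‖ ^ 2) = √(‖-(((2 / (1 + ‖w‖ ^ 2) : ℝ) : ℂ) * w)‖ ^ 2 +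
      (2 / (1 + ‖w‖ ^ 2)) ^ 2) := by
    intro w
    rw [eq_comm, Real.sqrt_eq_iff_mul_self_eq (by positivity) (by positivity), norm_neg, norm_mul,
      Complex.norm_real, Real.norm_of_nonneg (by positivity), div_mul_div_comm, Real.mul_self_sqrt (by positivity)]
    field_simp
    ring
  induction p using OnePoint.rec with
  | infty =>
    induction q using OnePoint.rec with
    | infty => simp [chordal]
    | coe w =>
      rw [dist_eq_norm, WithLp.prod_norm_eq_of_L2]
      change 2 / √(1 + ‖w‖ ^ 2) = √(‖(0 : ℂ) - ((2 / (1 + ‖w‖ ^ 2) : ℝ) : ℂ) * w‖ ^ 2 +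
        ‖(1 : ℝ) - (1 - 2 / (1 + ‖w‖ ^ 2))‖ ^ 2)
      rw [zero_sub, sub_sub_cancel, Real.norm_eq_abs, sq_abs]
      exact key w
  | coe z =>
    induction q using OnePoint.rec with
    | infty =>
      rw [dist_comm, dist_eq_norm, WithLp.prod_norm_eq_of_L2]
      change 2 / √(1 + ‖z‖ ^ 2) = √(‖(0 : ℂ) - ((2 / (1 + ‖z‖ ^ 2) : ℝ) : ℂ) * z‖ ^ 2 +
        ‖(1 : ℝ) - (1 - 2 / (1 + ‖z‖ ^ 2))‖ ^ 2)
      rw [zero_sub, sub_sub_cancel, Real.norm_eq_abs, sq_abs]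
      exact key z
    | coe w =>
      rw [dist_eq_norm, WithLp.prod_norm_eq_of_L2]
      change 2 * ‖z - w‖ / (√(1 + ‖z‖ ^ 2) * √(1 + ‖w‖ ^ 2)) =
        √(‖((2 / (1 + ‖z‖ ^ 2) : ℝ) : ℂ) * z - ((2 / (1 + ‖w‖ ^ 2) : ℝ) : ℂ) * w‖ ^ 2 +
        ‖1 - 2 / (1 + ‖z‖ ^ 2) - (1 - 2 / (1 + ‖w‖ ^ 2))‖ ^ 2)
      rw [eq_comm, Real.sqrt_eq_iff_mul_self_eq (by positivity) (by positivity), div_mul_div_comm,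
        mul_mul_mul_comm (√(1 + ‖z‖ ^ 2)), Real.mul_self_sqrt (by positivity), Real.mul_self_sqrt (by positivity)]
      have hz := one_add_norm_sq_pos z
      have hw := one_add_norm_sq_pos w
      simp only [← Complex.normSq_eq_norm_sq, Real.norm_eq_abs, sq_abs, Complex.normSq_apply] at hz hw ⊢
      rw [← pow_two (2 * ‖z - w‖), mul_pow, ← Complex.normSq_eq_norm_sq, Complex.normSq_apply]
      simp only [Complex.sub_re, Complex.sub_im, Complex.mul_re, Complex.mul_im, Complex.ofReal_re, Complex.ofReal_im]
      field_simp
      ring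

theorem chordal_comm (p q : CHat) : chordal p q = chordal q p := by
  simp only [chordal_eq_dist, dist_comm]

theorem chordal_self (p : CHat) : chordal p p = 0 := by simp [chordal_eq_dist]

theorem chordal_nonneg (p q : CHat) : 0 ≤ chordal p q := by
  rw [chordal_eq_dist]; exact dist_nonneg

theorem chordal_triangle (p q r : CHat) : chordal p r ≤ chordal p q + chordal q r := by
  simp only [chordal_eq_dist]; exact dist_triangle _ _ _

theorem abs_chordal_sub_le (p q r : CHat) : |chordal p r - chordal q r| ≤ chordal p q := by
  simp only [chordal_eq_dist]; exact abs_dist_sub_le _ _ _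

theorem norm_stereo (p : CHat) : ‖stereo p‖ = 1 := by
  induction p using OnePoint.rec with
  | infty => rw [WithLp.prod_norm_eq_of_L2]; simp [stereo]
  | coe z =>
    rw [WithLp.prod_norm_eq_of_L2]
    change √(‖((2 / (1 + ‖z‖ ^ 2) : ℝ) : ℂ) * z‖ ^ 2 + ‖1 - 2 / (1 + ‖z‖ ^ 2)‖ ^ 2) = 1
    rw [norm_mul, Complex.norm_real, Real.norm_of_nonneg (by positivity), Real.norm_eq_abs, sq_abs,
      Real.sqrt_eq_one]
    have := one_add_norm_sq_pos z
    field_simp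
    ring

theorem chordal_le_two (p q : CHat) : chordal p q ≤ 2 := by
  rw [chordal_eq_dist, dist_eq_norm]
  linarith [norm_sub_le (stereo p) (stereo q), norm_stereo p, norm_stereo q]

theorem chordal_eq_zero {p q : CHat} : chordal p q = 0 ↔ p = q := by
  refine ⟨fun h => ?_, fun h => h ▸ chordal_self p⟩
  induction p using OnePoint.rec with
  | infty =>
    induction q using OnePoint.rec with
    | infty => rfl
    | coe w =>
      simp [chordal] at h
      exact absurd h (Real.sqrt_pos.2 (one_add_norm_sq_pos w)).ne'
  | coe z =>
    induction q using OnePoint.rec with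
    | infty =>
      simp [chordal] at h
      exact absurd h (Real.sqrt_pos.2 (one_add_norm_sq_pos z)).ne'
    | coe w =>
      have h1 := (Real.sqrt_pos.2 (one_add_norm_sq_pos z)).ne'
      have h2 := (Real.sqrt_pos.2 (one_add_norm_sq_pos w)).ne'
      simp [chordal, h1, h2, sub_eq_zero] at h
      rw [h]

theorem chordal_pos {p q : CHat} (h : p ≠ q) : 0 < chordal p q :=
  lt_of_le_of_ne (chordal_nonneg p q) fun h0 => h (chordal_eq_zero.1 h0.symm)

theorem continuous_stereo : Continuous stereo := by
  rw [OnePoint.continuous_iff]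
  have hb : Tendsto (fun z : ℂ => 2 / (1 + ‖z‖ ^ 2)) (cocompact ℂ) (𝓝 0) := by
    refine tendsto_const_nhds.div_atTop (tendsto_atTop_add_const_left _ _ ?_)
    exact (tendsto_pow_atTop two_ne_zero).comp (tendsto_norm_cocompact_atTop)
  constructor
  · rw [coclosedCompact_eq_cocompact, tendsto_iff_norm_sub_tendsto_zero]
    have h1 : ∀ z : ℂ, ‖stereo z - stereo ∞‖ = chordal z ∞ := fun z => by
      rw [chordal_eq_dist, dist_eq_norm]
    simp only [h1]
    have h2 : ∀ z : ℂ, chordal z ∞ = 2 / √(1 + ‖z‖ ^ 2) := fun z => rfl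
    simp only [h2]
    refine tendsto_const_nhds.div_atTop (Real.tendsto_sqrt_atTop.comp (tendsto_atTop_add_const_left _ _ ?_))
    exact (tendsto_pow_atTop two_ne_zero).comp (tendsto_norm_cocompact_atTop)
  · have h1 : ∀ z : ℂ, 1 + ‖z‖ ^ 2 ≠ 0 := fun z => (one_add_norm_sq_pos z).ne'
    change Continuous fun z : ℂ => WithLp.toLp 2 (((2 / (1 + ‖z‖ ^ 2) : ℝ) : ℂ) * z, 1 - 2 / (1 + ‖z‖ ^ 2))
    refine (WithLp.prod_continuous_toLp 2 ℂ ℝ).comp ?_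
    have h2 : Continuous fun z : ℂ => 2 / (1 + ‖z‖ ^ 2) := by fun_prop (disch := exact h1 _)
    exact ((Complex.continuous_ofReal.comp h2).mul continuous_id).prodMk (continuous_const.sub h2)

theorem isClosedEmbedding_stereo : IsClosedEmbedding stereo :=
  continuous_stereo.isClosedEmbedding fun p q h =>
    chordal_eq_zero.1 (by rw [chordal_eq_dist, h, dist_self])

theorem continuous_chordal : Continuous fun x : CHat × CHat => chordal x.1 x.2 := by
  simp only [chordal_eq_dist]
  exact (continuous_stereo.comp continuous_fst).dist (continuous_stereo.comp continuous_snd)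

theorem continuous_chordal_left (q : CHat) : Continuous fun p => chordal p q :=
  continuous_chordal.comp (continuous_id.prodMk continuous_const)

theorem tendsto_iff_chordal {α : Type*} {l : Filter α} {f : α → CHat} {p : CHat} :
    Tendsto f l (𝓝 p) ↔ Tendsto (fun x => chordal (f x) p) l (𝓝 0) := by
  rw [isClosedEmbedding_stereo.isInducing.tendsto_nhds_iff, tendsto_iff_dist_tendsto_zero]
  simp only [chordal_eq_dist, Function.comp_def]

/-- The holomorphic coordinate on the sphere minus `e`, with a simple pole at `e`. -/
def chart (e q : CHat) : ℂ := e.elim (finiteCoord q) (fun a => q.elim 0 (fun z => (z - a)⁻¹))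

/-- The inverse of `chart e`. -/
def unchart (e : CHat) (w : ℂ) : CHat :=
  open scoped Classical in
  e.elim (w : CHat) (fun a => if w = 0 then ∞ else ((a + w⁻¹ : ℂ) : CHat))

/-- The pole of `coordAt p`. -/
def poleAt (p : CHat) : CHat := p.elim ((0 : ℂ) : CHat) (fun _ => ∞)

theorem coordAt_eq (p : CHat) : coordAt p = chart (poleAt p) := by
  induction p using OnePoint.rec with
  | infty =>
    ext q
    induction q using OnePoint.rec <;> simp [coordAt, chart, poleAt, inftyCoord]
  | coe z => rfl

theorem paramAt_eq (p : CHat) : paramAt p = unchart (poleAt p) := by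
  induction p using OnePoint.rec with
  | infty => ext1 w; simp [paramAt, unchart, poleAt]
  | coe z => rfl

theorem ne_poleAt (p : CHat) : p ≠ poleAt p := by
  induction p using OnePoint.rec <;> simp [poleAt]

theorem unchart_ne (e : CHat) (w : ℂ) : unchart e w ≠ e := by
  induction e using OnePoint.rec with
  | infty => simp [unchart]
  | coe a =>
    by_cases h : w = 0
    · simp [unchart, h]
    · simp [unchart, h]

theorem chart_unchart (e : CHat) (w : ℂ) : chart e (unchart e w) = w := by
  induction e using OnePoint.rec with
  | infty => simp [unchart, chart, finiteCoord]
  | coe a =>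
    by_cases h : w = 0
    · simp [unchart, chart, h]
    · simp [unchart, chart, h]

theorem unchart_chart {e q : CHat} (h : q ≠ e) : unchart e (chart e q) = q := by
  induction e using OnePoint.rec with
  | infty =>
    induction q using OnePoint.rec with
    | infty => exact absurd rfl h
    | coe z => simp [unchart, chart, finiteCoord]
  | coe a =>
    induction q using OnePoint.rec with
    | infty => simp [unchart, chart]
    | coe z =>
      have : z - a ≠ 0 := sub_ne_zero.2 fun h' => h (by rw [h'])
      simp [unchart, chart, this]

/-- The conformal factor of `chart e`. -/
def chartFactor (e : CHat) : ℝ := e.elim 2 (fun a => 2 / (1 + ‖a‖ ^ 2))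

theorem chartFactor_pos (e : CHat) : 0 < chartFactor e := by
  induction e using OnePoint.rec with
  | infty => simp [chartFactor]
  | coe a => simp only [chartFactor, OnePoint.elim_some]; positivity

/-- This is the distance formula for an inversion centred at e. Being an identity and not an
estimate, it gives all later comparisons between plane and chordal distances, with losses only from
the distances to the pole. -/
theorem norm_chart_sub {e p q : CHat} (hp : p ≠ e) (hq : q ≠ e) :
    ‖chart e p - chart e q‖ * (chordal p e * chordal q e) = chartFactor e * chordal p q := by
  have hs : ∀ z : ℂ, √(1 + ‖z‖ ^ 2) ≠ 0 := fun z => (Real.sqrt_pos.2 (one_add_norm_sq_pos z)).ne'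
  have hs2 : ∀ z : ℂ, √(1 + ‖z‖ ^ 2) ^ 2 = 1 + ‖z‖ ^ 2 := fun z =>
    Real.sq_sqrt (one_add_norm_sq_pos z).le
  induction e using OnePoint.rec with
  | infty =>
    lift p to ℂ using hp
    lift q to ℂ using hq
    have h1 := hs p
    have h2 := hs q
    simp only [chart, chartFactor, chordal, finiteCoord, OnePoint.elim_some, OnePoint.elim_infty]
    field_simp
  | coe a =>
    have h3 := hs a
    have h4 : chartFactor a = 2 / √(1 + ‖a‖ ^ 2) ^ 2 := by rw [hs2 a]; rfl
    rw [h4]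
    induction p using OnePoint.rec with
    | infty =>
      induction q using OnePoint.rec with
      | infty => simp [chordal, chart]
      | coe z =>
        have h1 := hs z
        have hz : ‖z - a‖ ≠ 0 := norm_ne_zero_iff.2 (sub_ne_zero.2 fun h' => hq (by rw [h']))
        simp only [chart, chordal, OnePoint.elim_some, OnePoint.elim_infty, zero_sub, norm_neg, norm_inv]
        field_simp
    | coe w =>
      have h1 := hs w
      have hw' : w - a ≠ 0 := (sub_ne_zero.2 fun h' => hp (by rw [h']))
      have hw : ‖w - a‖ ≠ 0 := norm_ne_zero_iff.2 hw'
      induction q using OnePoint.rec with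
      | infty =>
        simp only [chart, chordal, OnePoint.elim_some, OnePoint.elim_infty, sub_zero, norm_inv]
        field_simp
      | coe z =>
        have h2 := hs z
        have hz' : z - a ≠ 0 := (sub_ne_zero.2 fun h' => hq (by rw [h']))
        have hz : ‖z - a‖ ≠ 0 := norm_ne_zero_iff.2 hz'
        have e1 : (w - a)⁻¹ - (z - a)⁻¹ = -(w - z) / ((w - a) * (z - a)) := by
          field_simp; ring
        simp only [chart, chordal, OnePoint.elim_some, e1, norm_div, norm_neg, norm_mul]
        field_simp

theorem continuous_unchart (e : CHat) : Continuous (unchart e) := by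
  rw [continuous_iff_continuousAt]
  intro w
  rw [ContinuousAt, tendsto_iff_chordal]
  refine squeeze_zero (g := fun v => ‖v - w‖ * (4 / chartFactor e)) (fun v => chordal_nonneg _ _) (fun v => ?_) ?_
  · have h := norm_chart_sub (unchart_ne e v) (unchart_ne e w)
    rw [chart_unchart, chart_unchart] at h
    have hK := chartFactor_pos e
    rw [mul_div_assoc', le_div_iff₀ hK, mul_comm, ← h]
    refine mul_le_mul_of_nonneg_left ?_ (norm_nonneg _)
    nlinarith [chordal_le_two (unchart e v) e, chordal_le_two (unchart e w) e, chordal_nonneg (unchart e v) e, chordal_nonneg (unchart e w) e]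
  · have : Tendsto (fun v : ℂ => ‖v - w‖ * (4 / chartFactor e)) (𝓝 w) (𝓝 (‖w - w‖ * (4 / chartFactor e))) :=
      Continuous.tendsto (by fun_prop) w
    simpa using this

theorem continuousAt_chart {e q : CHat} (hq : q ≠ e) : ContinuousAt (chart e) q := by
  rw [ContinuousAt, tendsto_iff_norm_sub_tendsto_zero]
  have h1 : Tendsto (fun p => chartFactor e * chordal p q / (chordal p e * chordal q e)) (𝓝 q)
      (𝓝 (chartFactor e * chordal q q / (chordal q e * chordal q e))) :=
    ((continuous_chordal_left q).tendsto q |>.const_mul _).div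
      (((continuous_chordal_left e).tendsto q).mul_const _) (mul_pos (chordal_pos hq) (chordal_pos hq)).ne'
  rw [chordal_self, mul_zero, zero_div] at h1
  refine h1.congr' ?_
  filter_upwards [isOpen_ne.mem_nhds hq] with p hp
  rw [← norm_chart_sub hp hq, mul_div_cancel_right₀ _ (mul_pos (chordal_pos hp) (chordal_pos hq)).ne']

theorem differentiableAt_chart_unchart {e e' : CHat} {w : ℂ} (h : unchart e w ≠ e') :
    DifferentiableAt ℂ (fun v => chart e' (unchart e v)) w := by
  induction e using OnePoint.rec with
  | infty =>
    induction e' using OnePoint.rec with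
    | infty => exact differentiableAt_id
    | coe b =>
      have : w - b ≠ 0 := (sub_ne_zero.2 fun h' => h (by rw [h']; rfl))
      exact (differentiableAt_id.sub_const b).inv this
  | coe a =>
    induction e' using OnePoint.rec with
    | infty =>
      have hw : w ≠ 0 := fun h' => h (by simp [unchart, h'])
      refine DifferentiableAt.congr_of_eventuallyEq (f := fun v => a + v⁻¹) ?_ ?_
      · exact (differentiableAt_inv hw).const_add a
      · filter_upwards [isOpen_ne.mem_nhds hw] with v hv
        have hv : v ≠ 0 := hv
        simp [chart, unchart, finiteCoord, hv]
    | coe b =>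
      -- The Möbius formula also covers v = 0, which corresponds to ∞, because `chart b` vanishes
      -- there.
      have h1 : ∀ v : ℂ, chart b (unchart a v) = v / (v * (a - b) + 1) := by
        intro v
        by_cases hv : v = 0
        · simp [unchart, chart, hv]
        · simp only [unchart, chart, hv, OnePoint.elim_some, if_false]
          rw [inv_eq_one_div, ← mul_div_mul_left _ _ hv]
          congr 1
          · ring
          · field_simp
            ring
      simp only [h1]
      refine differentiableAt_id.div (by fun_prop) fun h0 => h ?_
      have hw : w ≠ 0 := fun h' => by simp [h'] at h0
      replace h0 : w * (a - b) + 1 = 0 := h0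
      simp only [unchart, hw, OnePoint.elim_some, if_false, OnePoint.coe_eq_coe]
      field_simp
      linear_combination h0

/-- Holomorphy in terms of the given coordinates is holomorphy in terms of all others. -/
theorem HolomorphicAt.differentiableAt_chart {f : CHat → CHat} {w : ℂ} {e e' : CHat}
    (hf : HolomorphicAt f (unchart e w)) (h : f (unchart e w) ≠ e') :
    DifferentiableAt ℂ (fun v => chart e' (f (unchart e v))) w := by
  obtain ⟨hc, hd⟩ := hf
  set p := unchart e w with hp
  rw [coordAt_eq, coordAt_eq, paramAt_eq] at hd
  have hpole : unchart (poleAt p) (chart (poleAt p) p) = p := unchart_chart (ne_poleAt p)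
  have h1 : DifferentiableAt ℂ (fun v => chart (poleAt p) (unchart e v)) w :=
    differentiableAt_chart_unchart (ne_poleAt p)
  have h2 : DifferentiableAt ℂ (fun v => chart e' (unchart (poleAt (f p)) v)) (chart (poleAt (f p)) (f p)) :=
    differentiableAt_chart_unchart (by rwa [unchart_chart (ne_poleAt (f p))])
  have h3 := DifferentiableAt.comp (x := w) (g := fun v => chart (poleAt (f p)) (f (unchart (poleAt p) v)))
    (f := fun v => chart (poleAt p) (unchart e v)) hd h1
  have h4 := DifferentiableAt.comp (x := w) (g := fun v => chart e' (unchart (poleAt (f p)) v))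
    (f := fun v => chart (poleAt (f p)) (f (unchart (poleAt p) (chart (poleAt p) (unchart e v)))))
    (by simp only [← hp, hpole]; exact h2) h3
  refine h4.congr_of_eventuallyEq ?_
  have hu : ContinuousAt (unchart e) w := (continuous_unchart e).continuousAt
  have hfu : ContinuousAt (fun v => f (unchart e v)) w := ContinuousAt.comp (f := unchart e) hc hu
  filter_upwards [hu.eventually_ne (ne_poleAt p), hfu.eventually_ne (ne_poleAt (f p))] with v hv1 hv2
  simp only [Function.comp_def]
  rw [unchart_chart hv1, unchart_chart hv2]

/-! ### Lipschitz paths, speed, and infima of weighted lengths -/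

/-- A Lipschitz path in `Ω` parametrized by `[a, b]`. -/
def IsLipPath (Ω : Set CHat) (γ : ℝ → CHat) (a b : ℝ) : Prop :=
  (∀ t ∈ Icc a b, γ t ∈ Ω) ∧
    ∃ K : ℝ, ∀ s ∈ Icc a b, ∀ t ∈ Icc a b, chordal (γ s) (γ t) ≤ K * |s - t|

/-- The integral of `ρ` with respect to arc length along `γ` restricted to `[a, b]`. -/
def arcIntegral (ρ : CHat → ℝ≥0∞) (γ : ℝ → CHat) (a b : ℝ) : ℝ≥0∞ :=
  ∫⁻ t in Icc a b, ρ (γ t) * ENNReal.ofReal (sphericalSpeed γ t)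

theorem isRectifiablePath_iff {Ω : Set CHat} {x y : CHat} {γ : ℝ → CHat} :
    IsRectifiablePath Ω x y γ ↔ γ 0 = x ∧ γ 1 = y ∧ IsLipPath Ω γ 0 1 := Iff.rfl

theorem IsLipPath.mono {Ω : Set CHat} {γ : ℝ → CHat} {a b c d : ℝ} (h : IsLipPath Ω γ a b)
    (hac : a ≤ c) (hdb : d ≤ b) : IsLipPath Ω γ c d := by
  obtain ⟨h1, K, hK⟩ := h
  exact ⟨fun t ht => h1 t (Icc_subset_Icc hac hdb ht), K, fun s hs t ht =>
    hK s (Icc_subset_Icc hac hdb hs) t (Icc_subset_Icc hac hdb ht)⟩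

theorem IsLipPath.exists_pos {Ω : Set CHat} {γ : ℝ → CHat} {a b : ℝ} (h : IsLipPath Ω γ a b) :
    ∃ K : ℝ, 0 < K ∧ ∀ s ∈ Icc a b, ∀ t ∈ Icc a b, chordal (γ s) (γ t) ≤ K * |s - t| := by
  obtain ⟨-, K, hK⟩ := h
  refine ⟨max K 1, by positivity, fun s hs t ht => (hK s hs t ht).trans ?_⟩
  gcongr
  exact le_max_left _ _

theorem IsLipPath.continuousOn {Ω : Set CHat} {γ : ℝ → CHat} {a b : ℝ} (h : IsLipPath Ω γ a b) :
    ContinuousOn γ (Icc a b) := by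
  obtain ⟨K, hK0, hK⟩ := h.exists_pos
  intro t ht
  rw [ContinuousWithinAt, tendsto_iff_chordal]
  have h1 : Tendsto (fun s : ℝ => K * |s - t|) (𝓝[Icc a b] t) (𝓝 (K * |t - t|)) :=
    (Continuous.tendsto (by fun_prop) t).mono_left nhdsWithin_le_nhds
  rw [sub_self, abs_zero, mul_zero] at h1
  exact squeeze_zero' (.of_forall fun s => chordal_nonneg _ _)
    (by filter_upwards [self_mem_nhdsWithin] with s hs using hK s hs t ht) h1

theorem IsLipPath.continuousAt {Ω : Set CHat} {γ : ℝ → CHat} {a b t : ℝ} (h : IsLipPath Ω γ a b)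
    (ht : t ∈ Ioo a b) : ContinuousAt γ t :=
  h.continuousOn.continuousAt (Icc_mem_nhds ht.1 ht.2)

theorem sphericalSpeed_nonneg (γ : ℝ → CHat) (t : ℝ) : 0 ≤ sphericalSpeed γ t := by
  unfold sphericalSpeed; positivity

theorem chordal_poleAt_sq (p : CHat) :
    chordal p (poleAt p) ^ 2 / chartFactor (poleAt p) = 2 / (1 + ‖chart (poleAt p) p‖ ^ 2) := by
  induction p using OnePoint.rec with
  | infty => simp [chordal, poleAt, chart, chartFactor]; norm_num
  | coe z =>
    have h := one_add_norm_sq_pos z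
    simp only [chordal, poleAt, chart, chartFactor, finiteCoord, OnePoint.elim_some, OnePoint.elim_infty,
      div_pow, Real.sq_sqrt h.le]
    field_simp

/-- The spherical speed is the metric derivative for the chordal metric. -/
theorem tendsto_chordal_div {γ : ℝ → CHat} {t : ℝ} (hc : ContinuousAt γ t)
    (hd : DifferentiableAt ℝ (fun s => coordAt (γ t) (γ s)) t) :
    Tendsto (fun s => chordal (γ s) (γ t) / |s - t|) (𝓝[≠] t) (𝓝 (sphericalSpeed γ t)) := by
  rw [sphericalSpeed]
  rw [coordAt_eq] at hd ⊢
  set p := γ t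
  set e := poleAt p
  have hpe : p ≠ e := ne_poleAt p
  have hK := chartFactor_pos e
  have h1 := hd.hasDerivAt.tendsto_slope.norm
  have h2 : Tendsto (fun s => chordal (γ s) e * chordal p e / chartFactor e) (𝓝[≠] t)
      (𝓝 (chordal p e * chordal p e / chartFactor e)) :=
    (((((continuous_chordal_left e).tendsto p).comp hc).mono_left nhdsWithin_le_nhds).mul_const _).div_const _
  have h3 := h1.mul h2
  have e1 : ‖deriv (fun s => chart e (γ s)) t‖ * (chordal p e * chordal p e / chartFactor e) =
      2 * ‖deriv (fun s => chart e (γ s)) t‖ / (1 + ‖chart e p‖ ^ 2) := by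
    rw [← pow_two, chordal_poleAt_sq]
    ring
  rw [e1] at h3
  refine h3.congr' ?_
  filter_upwards [(hc.eventually_ne hpe).filter_mono nhdsWithin_le_nhds] with s hs
  have h4 := norm_chart_sub hs hpe
  rw [slope_def_module, norm_smul, norm_inv, Real.norm_eq_abs]
  rw [mul_assoc, ← mul_div_assoc, h4, mul_div_cancel_left₀ _ hK.ne', mul_comm, div_eq_mul_inv]

/-- By the convention for `deriv`, non-differentiability can only decrease a length. Upper bounds
for the speed therefore need no differentiability, while lower bounds for lengths rest on
`ae_differentiableAt_coordAt`. -/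
theorem sphericalSpeed_eq_zero {γ : ℝ → CHat} {t : ℝ}
    (hd : ¬ DifferentiableAt ℝ (fun s => coordAt (γ t) (γ s)) t) : sphericalSpeed γ t = 0 := by
  simp [sphericalSpeed, deriv_zero_of_not_differentiableAt hd]

theorem sphericalSpeed_le {γ : ℝ → CHat} {t B : ℝ} (hB : 0 ≤ B) (hc : ContinuousAt γ t)
    (h : ∀ᶠ s in 𝓝[≠] t, chordal (γ s) (γ t) ≤ B * |s - t|) : sphericalSpeed γ t ≤ B := by
  by_cases hd : DifferentiableAt ℝ (fun s => coordAt (γ t) (γ s)) t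
  · refine le_of_tendsto (tendsto_chordal_div hc hd) ?_
    filter_upwards [h, self_mem_nhdsWithin] with s hs hst
    exact div_le_of_le_mul₀ (abs_nonneg _) hB hs
  · rw [sphericalSpeed_eq_zero hd]; exact hB

theorem coordAt_infty_eq (q : CHat) :
    inftyCoord q = (starRingEnd ℂ (stereo q).fst) / ((1 + (stereo q).snd : ℝ) : ℂ) := by
  induction q using OnePoint.rec with
  | infty => simp [inftyCoord, stereo]
  | coe z =>
    change z⁻¹ = (starRingEnd ℂ (((2 / (1 + ‖z‖ ^ 2) : ℝ) : ℂ) * z)) / ((1 + (1 - 2 / (1 + ‖z‖ ^ 2)) : ℝ) : ℂ)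
    by_cases hz : z = 0
    · simp [hz]
    · have h := one_add_norm_sq_pos z
      have h1 : (‖z‖ : ℝ) ≠ 0 := norm_ne_zero_iff.2 hz
      have e1 : (1 + (1 - 2 / (1 + ‖z‖ ^ 2)) : ℝ) = 2 / (1 + ‖z‖ ^ 2) * ‖z‖ ^ 2 := by
        field_simp; ring
      have h2 : ((2 / (1 + ‖z‖ ^ 2) : ℝ) : ℂ) ≠ 0 := Complex.ofReal_ne_zero.2 (by positivity)
      rw [e1, map_mul, Complex.conj_ofReal, Complex.ofReal_mul, mul_div_mul_left _ _ h2, Complex.inv_def,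
        Complex.normSq_eq_norm_sq, div_eq_mul_inv, Complex.ofReal_inv]

theorem finiteCoord_eq (q : CHat) :
    finiteCoord q = (stereo q).fst / ((1 - (stereo q).snd : ℝ) : ℂ) := by
  induction q using OnePoint.rec with
  | infty => simp [finiteCoord, stereo]
  | coe z =>
    change z = (((2 / (1 + ‖z‖ ^ 2) : ℝ) : ℂ) * z) / ((1 - (1 - 2 / (1 + ‖z‖ ^ 2)) : ℝ) : ℂ)
    have h2 : ((2 / (1 + ‖z‖ ^ 2) : ℝ) : ℂ) ≠ 0 :=
      Complex.ofReal_ne_zero.2 (by have := one_add_norm_sq_pos z; positivity)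
    rw [sub_sub_cancel, mul_div_cancel_left₀ _ h2]

/-- Rademacher's theorem applies to the path in Euclidean space, and near γ t the coordinate is a
quotient of real-linear functions of its components with nonzero denominator. -/
theorem ae_differentiableAt_coordAt {Ω : Set CHat} {γ : ℝ → CHat} {a b : ℝ}
    (h : IsLipPath Ω γ a b) :
    ∀ᵐ t ∂(volume.restrict (Ioo a b)), DifferentiableAt ℝ (fun s => coordAt (γ t) (γ s)) t := by
  obtain ⟨K, hK0, hK⟩ := h.exists_pos
  have h1 : LipschitzOnWith (Real.toNNReal K) (fun t => stereo (γ t)) (Ioo a b) := by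
    refine LipschitzOnWith.of_dist_le_mul fun s hs t ht => ?_
    rw [← chordal_eq_dist, Real.coe_toNNReal _ hK0.le, Real.dist_eq]
    exact hK s (Ioo_subset_Icc_self hs) t (Ioo_subset_Icc_self ht)
  filter_upwards [h1.ae_differentiableWithinAt_real measurableSet_Ioo,
    ae_restrict_mem measurableSet_Ioo] with t ht htm
  have hd : DifferentiableAt ℝ (fun t => stereo (γ t)) t :=
    ht.differentiableAt (isOpen_Ioo.mem_nhds htm)
  have hd1 : DifferentiableAt ℝ (fun t => (stereo (γ t)).fst) t :=
    (WithLp.fstL 2 ℝ ℂ ℝ).differentiableAt.comp t hd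
  have hd2 : DifferentiableAt ℝ (fun t => (stereo (γ t)).snd) t :=
    (WithLp.sndL 2 ℝ ℂ ℝ).differentiableAt.comp t hd
  generalize hp : γ t = p
  induction p using OnePoint.rec with
  | infty =>
    change DifferentiableAt ℝ (fun s => inftyCoord (γ s)) t
    simp only [coordAt_infty_eq]
    refine DifferentiableAt.div (Complex.conjCLE.differentiableAt.comp t hd1)
      (Complex.ofRealCLM.differentiableAt.comp t (hd2.const_add 1)) ?_
    rw [hp]
    simp [stereo]
  | coe z =>
    change DifferentiableAt ℝ (fun s => finiteCoord (γ s)) t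
    simp only [finiteCoord_eq]
    refine DifferentiableAt.div hd1 (Complex.ofRealCLM.differentiableAt.comp t (hd2.const_sub 1)) ?_
    rw [hp]
    change ((1 - (1 - 2 / (1 + ‖z‖ ^ 2)) : ℝ) : ℂ) ≠ 0
    rw [sub_sub_cancel]
    exact Complex.ofReal_ne_zero.2 (by have := one_add_norm_sq_pos z; positivity)

/-- A Lipschitz function is absolutely continuous, so its increment is the integral of its
derivative. Only monotonicity of the lower integral is used to pass to G, which is why G may be
non-measurable. -/
theorem ofReal_sub_le_lintegral {u : ℝ → ℝ} {G : ℝ → ℝ≥0∞} {a b K : ℝ} (hab : a ≤ b)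
    (hu : ∀ s ∈ Icc a b, ∀ t ∈ Icc a b, |u s - u t| ≤ K * |s - t|)
    (hG : ∀ᵐ t ∂(volume.restrict (Ioo a b)), DifferentiableAt ℝ u t → ENNReal.ofReal (deriv u t) ≤ G t) :
    ENNReal.ofReal (u b - u a) ≤ ∫⁻ t in Icc a b, G t := by
  have hL : LipschitzOnWith (Real.toNNReal K) u (uIcc a b) := by
    rw [uIcc_of_le hab]
    refine LipschitzOnWith.of_dist_le_mul fun s hs t ht => ?_
    rw [Real.dist_eq, Real.dist_eq]
    refine (hu s hs t ht).trans ?_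
    gcongr
    exact Real.le_coe_toNNReal K
  have hac := hL.absolutelyContinuousOnInterval
  have hint := hac.intervalIntegrable_deriv
  have hae : ∀ᵐ t ∂(volume.restrict (Ioo a b)), DifferentiableAt ℝ u t := by
    rw [ae_restrict_iff' measurableSet_Ioo]
    filter_upwards [hac.ae_differentiableAt] with t ht htm
    exact ht (by rw [uIcc_of_le hab]; exact Ioo_subset_Icc_self htm)
  rw [← hac.integral_deriv_eq_sub, intervalIntegral.integral_of_le hab, integral_Ioc_eq_integral_Ioo]
  rw [intervalIntegrable_iff_integrableOn_Ioo_of_le hab] at hint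
  calc ENNReal.ofReal (∫ t in Ioo a b, deriv u t)
      ≤ ENNReal.ofReal (∫ t in Ioo a b, max (deriv u t) 0) :=
        ENNReal.ofReal_le_ofReal (integral_mono hint hint.pos_part fun t => le_max_left _ _)
    _ = ∫⁻ t in Ioo a b, ENNReal.ofReal (max (deriv u t) 0) :=
        ofReal_integral_eq_lintegral_ofReal hint.pos_part (.of_forall fun t => le_max_right _ _)
    _ ≤ ∫⁻ t in Ioo a b, G t := by
        refine lintegral_mono_ae ?_
        filter_upwards [hG, hae] with t h1 h2
        rw [ENNReal.ofReal_max, ENNReal.ofReal_zero, max_eq_left (zero_le (a := ENNReal.ofReal (deriv u t)))]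
        exact h1 h2
    _ ≤ ∫⁻ t in Icc a b, G t := lintegral_mono_set Ioo_subset_Icc_self

theorem arcIntegral_eq_Ioo (ρ : CHat → ℝ≥0∞) (γ : ℝ → CHat) (a b : ℝ) :
    arcIntegral ρ γ a b = ∫⁻ t in Ioo a b, ρ (γ t) * ENNReal.ofReal (sphericalSpeed γ t) :=
  (setLIntegral_congr Ioo_ae_eq_Icc).symm

/-- A function that is locally controlled by the density `G` is controlled by the length
of paths with respect to `G`. -/
theorem ofReal_sub_le_arcIntegral {Ω : Set CHat} {γ : ℝ → CHat} {a b K : ℝ} {φ G : CHat → ℝ}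
    (hab : a ≤ b) (hγ : IsLipPath Ω γ a b) (hG : ∀ p ∈ Ω, 0 ≤ G p)
    (hK : ∀ s ∈ Icc a b, ∀ t ∈ Icc a b, |φ (γ s) - φ (γ t)| ≤ K * |s - t|)
    (hφ : ∀ p ∈ Ω, ∀ q ∈ Ω, φ q - φ p ≤ G p * chordal q p) :
    ENNReal.ofReal (φ (γ b) - φ (γ a)) ≤ arcIntegral (fun p => ENNReal.ofReal (G p)) γ a b := by
  refine ofReal_sub_le_lintegral (u := fun t => φ (γ t)) hab hK ?_
  filter_upwards [ae_differentiableAt_coordAt hγ, ae_restrict_mem measurableSet_Ioo] with t h1 ht h2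
  have hmem : ∀ s ∈ Ioo a b, γ s ∈ Ω := fun s hs => hγ.1 s (Ioo_subset_Icc_self hs)
  rw [← ENNReal.ofReal_mul (hG _ (hmem t ht))]
  refine ENNReal.ofReal_le_ofReal ?_
  -- From the right, |s - t| = s - t, so the signed slope of φ ∘ γ can be compared with the metric
  -- quotient.
  have hle : 𝓝[>] t ≤ 𝓝[≠] t := nhdsWithin_mono t fun s (hs : t < s) => hs.ne'
  have h3 := h2.hasDerivAt.tendsto_slope.mono_left hle
  have h4 := ((tendsto_chordal_div (hγ.continuousAt ht) h1).mono_left hle).const_mul (G (γ t))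
  refine le_of_tendsto_of_tendsto h3 h4 ?_
  filter_upwards [self_mem_nhdsWithin, mem_nhdsWithin_of_mem_nhds (isOpen_Ioo.mem_nhds ht)] with s hs hs2
  have hs' : 0 < s - t := sub_pos.2 hs
  rw [slope_def_field, abs_of_pos hs', ← mul_div_assoc]
  gcongr
  exact hφ _ (hmem t ht) _ (hmem s hs2)

theorem sphericalSpeed_comp_affine (γ : ℝ → CHat) (m c t : ℝ) :
    sphericalSpeed (fun s => γ (m * s + c)) t = |m| * sphericalSpeed γ (m * t + c) := by
  unfold sphericalSpeed
  have h := deriv_comp_mul_left m (fun s => coordAt (γ (m * t + c)) (γ (s + c))) t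
  have h' := deriv_comp_add_const (fun s => coordAt (γ (m * t + c)) (γ s)) c (m * t)
  simp only [] at h h' ⊢
  rw [h, h', norm_smul, Real.norm_eq_abs]
  ring

theorem arcIntegral_comp_affine (ρ : CHat → ℝ≥0∞) (γ : ℝ → CHat) {m c a b : ℝ} (hm : m ≠ 0) :
    arcIntegral ρ (fun s => γ (m * s + c)) a b =
      ∫⁻ t in (fun s => m * s + c) '' Icc a b, ρ (γ t) * ENNReal.ofReal (sphericalSpeed γ t) := by
  rw [lintegral_image_eq_lintegral_abs_deriv_mul (f' := fun _ => m) measurableSet_Icc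
    (fun x _ => by simpa using (((hasDerivAt_id x).const_mul m).add_const c).hasDerivWithinAt)
    (fun x _ y _ hxy => by simpa [hm] using hxy)]
  refine lintegral_congr fun t => ?_
  rw [sphericalSpeed_comp_affine, ENNReal.ofReal_mul (abs_nonneg m)]
  ring

/-- Arbitrary parameter intervals are allowed so that subpaths and concatenations need no separate
reparametrization. -/
theorem pathInf_le {Ω : Set CHat} {ρ : CHat → ℝ≥0∞} {γ : ℝ → CHat} {a b : ℝ} (hab : a < b)
    (hγ : IsLipPath Ω γ a b) : pathInf Ω ρ (γ a) (γ b) ≤ arcIntegral ρ γ a b := by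
  have h0 : 0 < b - a := sub_pos.2 hab
  have himg : (fun s => (b - a) * s + a) '' Icc 0 1 = Icc a b := by
    rw [image_affine_Icc' h0]; simp
  have h1 := arcIntegral_comp_affine ρ γ (a := 0) (b := 1) (c := a) h0.ne'
  rw [himg] at h1
  refine le_trans (iInf₂_le (fun s => γ ((b - a) * s + a)) ?_) h1.le
  have hmem : ∀ s ∈ Icc (0 : ℝ) 1, (b - a) * s + a ∈ Icc a b := fun s hs => by
    rw [← himg]; exact mem_image_of_mem _ hs
  obtain ⟨hΩ, K, hK⟩ := hγ
  refine ⟨by simp, by simp, fun t ht => hΩ _ (hmem t ht), K * (b - a), fun s hs t ht => ?_⟩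
  refine (hK _ (hmem s hs) _ (hmem t ht)).trans (le_of_eq ?_)
  rw [add_sub_add_right_eq_sub, ← mul_sub, abs_mul, abs_of_pos h0, mul_assoc]

theorem pathInf_self {Ω : Set CHat} {ρ : CHat → ℝ≥0∞} {x : CHat} (hx : x ∈ Ω) :
    pathInf Ω ρ x x = 0 := by
  refine le_antisymm (le_trans (iInf₂_le (fun _ => x)
    ⟨rfl, rfl, fun _ _ => hx, 0, fun _ _ _ _ => by simp [chordal_self]⟩) ?_) bot_le
  simp [lineIntegral, sphericalSpeed]

theorem pathInf_comm_le (Ω : Set CHat) (ρ : CHat → ℝ≥0∞) (x y : CHat) :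
    pathInf Ω ρ y x ≤ pathInf Ω ρ x y := by
  refine le_iInf₂ fun γ hγ => ?_
  obtain ⟨h0, h1, hΩ, K, hK⟩ := hγ
  have himg : (fun s : ℝ => (-1) * s + 1) '' Icc 0 1 = Icc 0 1 := by
    ext t
    simp only [mem_image, mem_Icc]
    exact ⟨fun ⟨s, hs, h⟩ => by constructor <;> linarith, fun ht => ⟨1 - t, by constructor <;> linarith, by ring⟩⟩
  have h2 := arcIntegral_comp_affine ρ γ (a := 0) (b := 1) (m := -1) (c := 1) (by norm_num)
  rw [himg] at h2
  refine le_trans (iInf₂_le (fun s => γ ((-1) * s + 1)) ?_) h2.le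
  have hmem : ∀ s ∈ Icc (0 : ℝ) 1, (-1) * s + 1 ∈ Icc (0 : ℝ) 1 := fun s hs => by
    rw [← himg]; exact mem_image_of_mem (fun s : ℝ => (-1) * s + 1) hs
  refine ⟨by simp [h1], by simp [h0], fun t ht => hΩ _ (hmem t ht), K, fun s hs t ht => ?_⟩
  refine (hK _ (hmem s hs) _ (hmem t ht)).trans (le_of_eq ?_)
  rw [add_sub_add_right_eq_sub, ← mul_sub, abs_mul]
  simp

theorem pathInf_comm (Ω : Set CHat) (ρ : CHat → ℝ≥0∞) (x y : CHat) :
    pathInf Ω ρ x y = pathInf Ω ρ y x :=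
  le_antisymm (pathInf_comm_le _ _ _ _) (pathInf_comm_le _ _ _ _)

theorem sphericalSpeed_congr {γ γ' : ℝ → CHat} {t : ℝ} (h : γ =ᶠ[𝓝 t] γ') :
    sphericalSpeed γ t = sphericalSpeed γ' t := by
  unfold sphericalSpeed
  rw [h.eq_of_nhds, Filter.EventuallyEq.deriv_eq]
  filter_upwards [h] with s hs
  rw [hs]

theorem arcIntegral_congr {γ γ' : ℝ → CHat} {a b : ℝ} (ρ : CHat → ℝ≥0∞)
    (h : ∀ t ∈ Ioo a b, γ t = γ' t) : arcIntegral ρ γ a b = arcIntegral ρ γ' a b := by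
  rw [arcIntegral_eq_Ioo, arcIntegral_eq_Ioo]
  refine setLIntegral_congr_fun measurableSet_Ioo fun t ht => ?_
  rw [h t ht, sphericalSpeed_congr (γ' := γ')
    (by filter_upwards [isOpen_Ioo.mem_nhds ht] with s hs using h s hs)]

theorem arcIntegral_le_add (ρ : CHat → ℝ≥0∞) (γ : ℝ → CHat) {a b c : ℝ} (hab : a ≤ b) (hbc : b ≤ c) :
    arcIntegral ρ γ a c ≤ arcIntegral ρ γ a b + arcIntegral ρ γ b c := by
  unfold arcIntegral
  rw [← Icc_union_Icc_eq_Icc hab hbc]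
  exact lintegral_union_le _ _ _

/-- The common endpoint is removed from the second interval to make the two pieces disjoint; again
no measurability of ρ is needed. -/
theorem arcIntegral_add_le (ρ : CHat → ℝ≥0∞) (γ : ℝ → CHat) {a b c : ℝ} (hab : a ≤ b) (hbc : b ≤ c) :
    arcIntegral ρ γ a b + arcIntegral ρ γ b c ≤ arcIntegral ρ γ a c := by
  rw [arcIntegral_eq_Ioo ρ γ b c, arcIntegral, arcIntegral]
  rw [← lintegral_union measurableSet_Ioo (disjoint_left.2 fun t h1 h2 => absurd h2.1 (not_lt.2 h1.2))]
  refine lintegral_mono_set (union_subset (Icc_subset_Icc_right hbc) ?_)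
  exact fun t ht => ⟨hab.trans ht.1.le, ht.2.le⟩

theorem pathInf_triangle (Ω : Set CHat) (ρ : CHat → ℝ≥0∞) (x y z : CHat) :
    pathInf Ω ρ x z ≤ pathInf Ω ρ x y + pathInf Ω ρ y z := by
  refine ENNReal.le_iInf₂_add_iInf₂ fun γ hγ γ' hγ' => ?_
  obtain ⟨h0, h1, hlip⟩ := isRectifiablePath_iff.1 hγ
  obtain ⟨h0', h1', hlip'⟩ := isRectifiablePath_iff.1 hγ'
  obtain ⟨K, hK0, hK⟩ := hlip.exists_pos
  obtain ⟨K', hK0', hK'⟩ := hlip'.exists_pos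
  set η : ℝ → CHat := fun t => if t ≤ 1 then γ t else γ' (t - 1) with hη
  have e1 : ∀ t, t ≤ 1 → η t = γ t := fun t ht => if_pos ht
  have e2 : ∀ t, 1 ≤ t → η t = γ' (t - 1) := fun t ht => by
    rcases ht.eq_or_lt with rfl | h
    · simp [hη, h1, h0']
    · exact if_neg (not_le.2 h)
  have hle : ∀ s ∈ Icc (0 : ℝ) 2, ∀ t ∈ Icc (0 : ℝ) 2, s ≤ t →
      chordal (η s) (η t) ≤ max K K' * |s - t| := by
    intro s hs t ht hst
    rw [abs_sub_comm, abs_of_nonneg (sub_nonneg.2 hst)]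
    have hm1 := le_max_left K K'
    have hm2 := le_max_right K K'
    rcases le_total t 1 with h | h
    · rw [e1 t h, e1 s (hst.trans h)]
      refine (hK s ⟨hs.1, hst.trans h⟩ t ⟨ht.1, h⟩).trans ?_
      rw [abs_sub_comm, abs_of_nonneg (sub_nonneg.2 hst)]
      nlinarith
    · rcases le_total s 1 with h' | h'
      · rw [e2 t h, e1 s h']
        have a1 := hK s ⟨hs.1, h'⟩ 1 (by simp)
        have a2 := hK' 0 (by simp) (t - 1) ⟨by linarith, by linarith [ht.2]⟩
        rw [abs_sub_comm, abs_of_nonneg (by linarith)] at a1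
        rw [abs_sub_comm, abs_of_nonneg (by linarith)] at a2
        rw [h1] at a1
        rw [h0'] at a2
        have := chordal_triangle (γ s) y (γ' (t - 1))
        nlinarith
      · rw [e2 t h, e2 s h']
        refine (hK' _ ⟨by linarith, by linarith [hs.2]⟩ _ ⟨by linarith, by linarith [ht.2]⟩).trans ?_
        rw [sub_sub_sub_cancel_right, abs_sub_comm, abs_of_nonneg (sub_nonneg.2 hst)]
        nlinarith
  have hη : IsLipPath Ω η 0 2 := by
    refine ⟨fun t ht => ?_, max K K', fun s hs t ht => ?_⟩
    · rcases le_total t 1 with h | h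
      · rw [e1 t h]; exact hlip.1 t ⟨ht.1, h⟩
      · rw [e2 t h]; exact hlip'.1 _ ⟨by linarith, by linarith [ht.2]⟩
    · rcases le_total s t with h | h
      · exact hle s hs t ht h
      · rw [chordal_comm, abs_sub_comm]; exact hle t ht s hs h
  have h2 := pathInf_le (ρ := ρ) (by norm_num : (0 : ℝ) < 2) hη
  rw [e1 0 (by norm_num), e2 2 (by norm_num), h0, show (2 : ℝ) - 1 = 1 by norm_num, h1'] at h2
  refine h2.trans ((arcIntegral_le_add ρ η (b := 1) (by norm_num) (by norm_num)).trans ?_)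
  refine add_le_add ?_ ?_
  · rw [arcIntegral_congr ρ (γ' := γ) fun t ht => e1 t ht.2.le]
    exact le_rfl
  · rw [arcIntegral_congr ρ (γ' := fun t => γ' (1 * t + (-1))) fun t ht => by
      rw [e2 t ht.1.le]; congr 1; ring]
    rw [arcIntegral_comp_affine ρ γ' one_ne_zero, image_affine_Icc' one_pos]
    norm_num
    exact le_rfl

/-! ### Comparison of the spherical and the chordal metric -/

theorem chordal_unchart_le (e : CHat) (v w : ℂ) :
    chordal (unchart e v) (unchart e w) ≤ 4 / chartFactor e * ‖v - w‖ := by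
  have h := norm_chart_sub (unchart_ne e v) (unchart_ne e w)
  rw [chart_unchart, chart_unchart] at h
  rw [div_mul_eq_mul_div, le_div_iff₀ (chartFactor_pos e), mul_comm, ← h, mul_comm]
  refine mul_le_mul_of_nonneg_right ?_ (norm_nonneg _)
  nlinarith [chordal_le_two (unchart e v) e, chordal_le_two (unchart e w) e,
    chordal_nonneg (unchart e v) e, chordal_nonneg (unchart e w) e]

theorem arcIntegral_le_of_le {Ω : Set CHat} {ρ : CHat → ℝ≥0∞} {γ : ℝ → CHat} {a b K : ℝ} {M : ℝ≥0∞}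
    (hK0 : 0 ≤ K) (hΩ : ∀ t ∈ Icc a b, γ t ∈ Ω)
    (hK : ∀ s ∈ Icc a b, ∀ t ∈ Icc a b, chordal (γ s) (γ t) ≤ K * |s - t|)
    (hM : ∀ t ∈ Icc a b, ρ (γ t) ≤ M) :
    arcIntegral ρ γ a b ≤ M * ENNReal.ofReal K * ENNReal.ofReal (b - a) := by
  rw [arcIntegral_eq_Ioo, ← Real.volume_Ioo, ← setLIntegral_const]
  refine setLIntegral_mono' measurableSet_Ioo fun t ht => ?_
  have hlip : IsLipPath Ω γ a b := ⟨hΩ, K, hK⟩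
  refine mul_le_mul' (hM t (Ioo_subset_Icc_self ht)) (ENNReal.ofReal_le_ofReal ?_)
  refine sphericalSpeed_le hK0 (hlip.continuousAt ht) ?_
  filter_upwards [mem_nhdsWithin_of_mem_nhds (isOpen_Ioo.mem_nhds ht)] with s hs
  exact hK s (Ioo_subset_Icc_self hs) t (Ioo_subset_Icc_self ht)

/-- Estimate by the path that is a segment in the coordinate `chart e`. -/
theorem pathInf_le_of_segment {Ω : Set CHat} {ρ : CHat → ℝ≥0∞} {e p q : CHat} {M : ℝ≥0∞}
    (hp : p ≠ e) (hq : q ≠ e)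
    (h : ∀ w ∈ segment ℝ (chart e p) (chart e q), unchart e w ∈ Ω ∧ ρ (unchart e w) ≤ M) :
    pathInf Ω ρ p q ≤ M * ENNReal.ofReal (4 / chartFactor e * ‖chart e p - chart e q‖) := by
  set γ : ℝ → CHat := fun t => unchart e (chart e p + t • (chart e q - chart e p)) with hγ
  have hseg : ∀ t ∈ Icc (0 : ℝ) 1, chart e p + t • (chart e q - chart e p) ∈
      segment ℝ (chart e p) (chart e q) := fun t ht => by
    rw [segment_eq_image']; exact mem_image_of_mem _ ht
  have hΩ : ∀ t ∈ Icc (0 : ℝ) 1, γ t ∈ Ω := fun t ht => (h _ (hseg t ht)).1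
  have hfac : 0 ≤ 4 / chartFactor e := by have := chartFactor_pos e; positivity
  have hK : ∀ s ∈ Icc (0 : ℝ) 1, ∀ t ∈ Icc (0 : ℝ) 1, chordal (γ s) (γ t) ≤
      4 / chartFactor e * ‖chart e p - chart e q‖ * |s - t| := fun s _ t _ => by
    refine (chordal_unchart_le e _ _).trans (le_of_eq ?_)
    rw [add_sub_add_left_eq_sub, ← sub_smul, norm_smul, Real.norm_eq_abs, norm_sub_rev (chart e q)]
    ring
  have h0 : γ 0 = p := by simp [hγ, unchart_chart hp]
  have h1 : γ 1 = q := by simp [hγ, unchart_chart hq]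
  have h2 := pathInf_le (ρ := ρ) zero_lt_one (⟨hΩ, _, hK⟩ : IsLipPath Ω γ 0 1)
  rw [h0, h1] at h2
  refine h2.trans ((arcIntegral_le_of_le (by positivity) hΩ hK fun t ht => (h _ (hseg t ht)).2).trans ?_)
  simp

/-- The points 0, 1, ∞ have mutual distances greater than 1. Each of p and q is within 1/2 of at
most one of them, so one remains for the pole. -/
theorem exists_far_point (p q : CHat) : ∃ e : CHat, 1 / 2 ≤ chordal p e ∧ 1 / 2 ≤ chordal q e := by
  have h01 : 1 < chordal ((0 : ℂ) : CHat) ((1 : ℂ) : CHat) := by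
    simp only [chordal, OnePoint.elim_some]
    norm_num
    exact Real.one_lt_sqrt_two
  have h0 : 1 < chordal ((0 : ℂ) : CHat) ∞ := by
    simp [chordal]
  have h1 : 1 < chordal ((1 : ℂ) : CHat) ∞ := by
    simp only [chordal, OnePoint.elim_some, OnePoint.elim_infty]
    norm_num
    exact Real.one_lt_sqrt_two
  by_contra! hcon
  have c0 := hcon ((0 : ℂ) : CHat)
  have c1 := hcon ((1 : ℂ) : CHat)
  have c2 := hcon ∞
  have key : ∀ x a b : CHat, 1 < chordal a b → chordal x a < 1 / 2 → 1 / 2 ≤ chordal x b := by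
    intro x a b hab hx
    have := chordal_triangle a x b
    rw [chordal_comm a x] at this
    linarith
  rcases lt_or_ge (chordal p ((0 : ℂ) : CHat)) (1 / 2) with hp | hp
  · have a1 := c1 (key _ _ _ h01 hp)
    have a2 := c2 (key _ _ _ h0 hp)
    linarith [key _ _ _ h1 a1]
  · have a0 := c0 hp
    have a1 := key _ _ _ h01 a0
    have a2 := key _ _ _ h0 a0
    rcases lt_or_ge (chordal p ((1 : ℂ) : CHat)) (1 / 2) with hp1 | hp1
    · linarith [c2 (key _ _ _ h1 hp1)]
    · linarith [c1 hp1]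

theorem ne_of_half_le {p e : CHat} (h : 1 / 2 ≤ chordal p e) : p ≠ e := by
  rintro rfl
  rw [chordal_self] at h
  norm_num at h

theorem chart_dist_le {e p q : CHat} (hp : 1 / 2 ≤ chordal p e) (hq : 1 / 2 ≤ chordal q e) :
    4 / chartFactor e * ‖chart e p - chart e q‖ ≤ 16 * chordal p q := by
  have h := norm_chart_sub (ne_of_half_le hp) (ne_of_half_le hq)
  have hK := chartFactor_pos e
  rw [div_mul_eq_mul_div, div_le_iff₀ hK]
  have h2 : 1 / 4 ≤ chordal p e * chordal q e := by nlinarith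
  nlinarith [norm_nonneg (chart e p - chart e q)]

/-- A straight segment in a coordinate whose pole has distance at least 1/2 from both points is
short enough. The factor 16 is not sharp, but any absolute constant suffices. -/
theorem sphericalDist_le (p q : CHat) : sphericalDist p q ≤ ENNReal.ofReal (16 * chordal p q) := by
  obtain ⟨e, hp, hq⟩ := exists_far_point p q
  refine (pathInf_le_of_segment (M := 1) (ne_of_half_le hp) (ne_of_half_le hq) fun w _ => ⟨mem_univ _, le_rfl⟩).trans ?_
  rw [one_mul]
  exact ENNReal.ofReal_le_ofReal (chart_dist_le hp hq)

theorem chordal_le_sphericalDist (p q : CHat) : ENNReal.ofReal (chordal p q) ≤ sphericalDist p q := by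
  refine le_iInf₂ fun γ hγ => ?_
  obtain ⟨h0, h1, hlip⟩ := isRectifiablePath_iff.1 hγ
  obtain ⟨K, -, hK⟩ := hlip.exists_pos
  have h2 := ofReal_sub_le_arcIntegral (φ := fun r => chordal r p) (G := fun _ => 1) zero_le_one hlip
    (fun _ _ => zero_le_one) (K := K)
    (fun s hs t ht => (abs_chordal_sub_le _ _ _).trans (hK s hs t ht)) (fun r _ s _ => by
      have := chordal_triangle s r p
      linarith)
  rw [h0, h1, chordal_self, sub_zero, chordal_comm] at h2
  simpa [lineIntegral, arcIntegral] using h2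

/-! ### Distance to the boundary and the quasihyperbolic density -/

/-- The chordal distance to the boundary. -/
def bdist (Ω : Set CHat) (p : CHat) : ℝ := Metric.infDist (stereo p) (stereo '' frontier Ω)

theorem bdist_nonneg (Ω : Set CHat) (p : CHat) : 0 ≤ bdist Ω p := Metric.infDist_nonneg

theorem bdist_le {Ω : Set CHat} {p b : CHat} (hb : b ∈ frontier Ω) : bdist Ω p ≤ chordal p b := by
  rw [chordal_eq_dist]
  exact Metric.infDist_le_dist_of_mem (mem_image_of_mem _ hb)

theorem bdist_le_add (Ω : Set CHat) (p q : CHat) : bdist Ω p ≤ bdist Ω q + chordal p q := by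
  rw [chordal_eq_dist]
  exact Metric.infDist_le_infDist_add_dist

theorem continuous_bdist (Ω : Set CHat) : Continuous (bdist Ω) :=
  (Metric.continuous_infDist_pt _).comp continuous_stereo

theorem exists_bdist_eq {Ω : Set CHat} (h : (frontier Ω).Nonempty) (p : CHat) :
    ∃ b ∈ frontier Ω, bdist Ω p = chordal p b := by
  have hc : IsCompact (stereo '' frontier Ω) := isClosed_frontier.isCompact.image continuous_stereo
  obtain ⟨_, ⟨b, hb, rfl⟩, h2⟩ := hc.exists_infDist_eq_dist (h.image _) (stereo p)
  exact ⟨b, hb, by rw [chordal_eq_dist]; exact h2⟩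

theorem bdist_le_two {Ω : Set CHat} (h : (frontier Ω).Nonempty) (p : CHat) : bdist Ω p ≤ 2 := by
  obtain ⟨b, hb⟩ := h
  exact (bdist_le hb).trans (chordal_le_two _ _)

theorem notMem_of_mem_frontier {Ω : Set CHat} (hΩ : IsOpen Ω) {b : CHat} (hb : b ∈ frontier Ω) :
    b ∉ Ω := by
  rw [hΩ.frontier_eq] at hb
  exact hb.2

theorem bdist_pos {Ω : Set CHat} (hΩ : IsOpen Ω) (h : (frontier Ω).Nonempty) {p : CHat} (hp : p ∈ Ω) :
    0 < bdist Ω p := by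
  obtain ⟨b, hb, h2⟩ := exists_bdist_eq h p
  rw [h2]
  exact chordal_pos fun h3 => notMem_of_mem_frontier hΩ hb (h3 ▸ hp)

/-- The density of the quasihyperbolic metric. -/
def qhDensity (Ω : Set CHat) (p : CHat) : ℝ≥0∞ := (sphericalInfDist p (frontier Ω))⁻¹

theorem qhEDist_eq (Ω : Set CHat) (x y : CHat) : qhEDist Ω x y = pathInf Ω (qhDensity Ω) x y := rfl

theorem qhDensity_le {Ω : Set CHat} {p : CHat} (hp : 0 < bdist Ω p) :
    qhDensity Ω p ≤ ENNReal.ofReal (bdist Ω p)⁻¹ := by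
  rw [ENNReal.ofReal_inv_of_pos hp]
  refine ENNReal.inv_le_inv.2 (le_iInf₂ fun w hw => ?_)
  exact (ENNReal.ofReal_le_ofReal (bdist_le hw)).trans (chordal_le_sphericalDist _ _)

theorem le_qhDensity {Ω : Set CHat} (h : (frontier Ω).Nonempty) {p : CHat} (hp : 0 < bdist Ω p) :
    ENNReal.ofReal (16 * bdist Ω p)⁻¹ ≤ qhDensity Ω p := by
  rw [ENNReal.ofReal_inv_of_pos (by positivity)]
  refine ENNReal.inv_le_inv.2 ?_
  obtain ⟨b, hb, h2⟩ := exists_bdist_eq h p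
  rw [h2]
  exact (iInf₂_le b hb).trans (sphericalDist_le p b)

theorem frontier_nonempty {Ω : Set CHat} (hΩ : IsConnected Ω) (h : Ωᶜ.Nonempty) :
    (frontier Ω).Nonempty :=
  nonempty_frontier_iff.2 ⟨hΩ.nonempty, fun h' => by simp [h'] at h⟩

theorem subset_of_disjoint_frontier {Ω s : Set CHat} (hΩ : IsOpen Ω) (hs : IsPreconnected s)
    (hne : (s ∩ Ω).Nonempty) (hd : ∀ p ∈ s, p ∉ frontier Ω) : s ⊆ Ω := by
  refine (hs.subset_or_subset hΩ isClosed_closure.isOpen_compl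
    (disjoint_compl_right.mono_left subset_closure |>.mono_right le_rfl) fun p hp => ?_).resolve_right fun h => ?_
  · by_contra hcon
    rw [mem_union, not_or, mem_compl_iff, not_not] at hcon
    exact hd p hp (by rw [hΩ.frontier_eq]; exact ⟨hcon.2, hcon.1⟩)
  · obtain ⟨p, hp, hpΩ⟩ := hne
    exact h hp (subset_closure hpΩ)

/-- Points of large mutual distance in a set give a point of the set far from any given point. -/
theorem exists_far_mem {E : Set CHat} {c : ℝ} (h : ∃ p ∈ E, ∃ q ∈ E, c ≤ chordal p q) (x : CHat) :
    ∃ e ∈ E, c / 2 ≤ chordal x e := by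
  obtain ⟨p, hp, q, hq, hpq⟩ := h
  by_contra! hcon
  have h1 := hcon p hp
  have h2 := hcon q hq
  have h3 := chordal_triangle p x q
  rw [chordal_comm p x] at h3
  linarith

/-- Since spherical distance is at most 16 times chordal distance, chordal distances below a/32
would bound the diameter by a/2. The spare factor 2 is there because the supremum need not be
attained. -/
theorem exists_chordal_ge {E : Set CHat} {a : ℝ} (ha : 0 < a) (h : ENNReal.ofReal a ≤ sphericalDiam E) :
    ∃ p ∈ E, ∃ q ∈ E, a / 32 ≤ chordal p q := by
  by_contra! hcon
  have h1 : sphericalDiam E ≤ ENNReal.ofReal (a / 2) := by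
    refine iSup₂_le fun p hp => iSup₂_le fun q hq => (sphericalDist_le p q).trans ?_
    exact ENNReal.ofReal_le_ofReal (by linarith [hcon p hp q hq])
  have h2 := h.trans h1
  rw [ENNReal.ofReal_le_ofReal_iff (by positivity)] at h2
  linarith

/-! ### Dilatation of conformal maps and the bi-Lipschitz estimate -/

/-- Distortion of a conformal map at a point, in terms of the distances to the boundaries. -/
theorem eventually_chordal_map_le {U V : Set CHat} {f : CHat → CHat} {c : ℝ} (hc : 0 < c)
    (hU : IsOpen U) (hV : IsOpen V) (hVf : (frontier V).Nonempty)
    (hUf : (frontier U).Nonempty)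
    (hUc : ∃ p ∈ Uᶜ, ∃ q ∈ Uᶜ, c ≤ chordal p q) (hVc : ∃ p ∈ Vᶜ, ∃ q ∈ Vᶜ, c ≤ chordal p q)
    (hf : MapsTo f U V) (hinj : InjOn f U)
    (hd : ∀ e ∈ Uᶜ, ∀ e' ∈ Vᶜ, ∀ w, unchart e w ∈ U →
      DifferentiableAt ℂ (fun v => chart e' (f (unchart e v))) w)
    (hcont : ∀ p ∈ U, ContinuousAt f p)
    {z : CHat} (hz : z ∈ U) {ε : ℝ} (hε : 0 < ε) :
    ∀ᶠ q in 𝓝 z, chordal (f q) (f z) ≤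
      (384 / c ^ 2 * (bdist V (f z) / bdist U z) + ε) * chordal q z := by
  -- The pole e' is taken far from b, the boundary point nearest to f z, and not from f z itself.
  -- The distance from f z to e' ends up in the numerator, where the bound 2 is enough.
  obtain ⟨e, he, hze⟩ := exists_far_mem hUc z
  obtain ⟨b, hb, hbd⟩ := exists_bdist_eq hVf (f z)
  obtain ⟨e', he', hbe'⟩ := exists_far_mem hVc b
  have hbV := notMem_of_mem_frontier hV hb
  have hD := bdist_pos hU hUf hz
  have hD' := bdist_pos hV hVf (hf hz)
  have hne : ∀ p ∈ U, p ≠ e := fun p hp h => he (h ▸ hp)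
  have hne' : ∀ p ∈ V, p ≠ e' := fun p hp h => he' (h ▸ hp)
  have hbne : b ≠ e' := fun h => by rw [h, chordal_self] at hbe'; linarith
  have hK := chartFactor_pos e
  have hK' := chartFactor_pos e'
  have hχ : 0 < chordal z e := by linarith
  have hχ' := chordal_pos (hne' _ (hf hz))
  have hχb := chordal_pos hbne
  set w := chart e z with hw
  have huw : unchart e w = z := unchart_chart (hne z hz)
  set F : ℂ → ℂ := fun v => chart e' (f (unchart e v)) with hF
  -- By `norm_chart_sub` and chordal distances being at most 2, no boundary point of U has its
  -- coordinate within R of w.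
  set R := chartFactor e * bdist U z / (2 * chordal z e) with hRdef
  have hR : 0 < R := by positivity
  have hball : ∀ v ∈ Metric.ball w R, unchart e v ∈ U := by
    have := subset_of_disjoint_frontier (s := unchart e '' Metric.ball w R) hU
      ((convex_ball w R).isPreconnected.image _ (continuous_unchart e).continuousOn)
      ⟨z, ⟨w, Metric.mem_ball_self hR, huw⟩, hz⟩ ?_
    · exact fun v hv => this (mem_image_of_mem _ hv)
    · rintro _ ⟨v, hv, rfl⟩ hfr
      have h1 := bdist_le (p := z) hfr
      have h2 := norm_chart_sub (unchart_ne e v) (hne z hz)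
      rw [chart_unchart] at h2
      rw [Metric.mem_ball, dist_eq_norm, hRdef, lt_div_iff₀ (by positivity)] at hv
      have h3 := chordal_le_two (unchart e v) e
      rw [chordal_comm z] at h1
      nlinarith [mul_nonneg (norm_nonneg (v - w)) hχ.le]
  have hFd : DifferentiableOn ℂ F (Metric.ball w R) := fun v hv =>
    (hd e he e' he' v (hball v hv)).differentiableWithinAt
  have hFinj : InjOn F (Metric.ball w R) := by
    intro v hv v' hv' h
    have h1 := congrArg (unchart e') h
    simp only [hF] at h1
    rw [unchart_chart (hne' _ (hf (hball v hv))), unchart_chart (hne' _ (hf (hball v' hv')))] at h1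
    have h2 := congrArg (chart e) (hinj (hball v hv) (hball v' hv') h1)
    rwa [chart_unchart, chart_unchart] at h2
  have hp : chart e' b ∉ F '' Metric.ball w R := by
    rintro ⟨v, hv, h⟩
    have h1 := congrArg (unchart e') h
    simp only [hF] at h1
    rw [unchart_chart (hne' _ (hf (hball v hv))), unchart_chart hbne] at h1
    exact hbV (h1 ▸ hf (hball v hv))
  have hkoebe := koebe_weak hR hFd hFinj hp
  have hFw : F w = chart e' (f z) := by simp only [hF, huw]
  have hFder : HasDerivAt F (deriv F w) w :=
    (hFd.differentiableAt (Metric.ball_mem_nhds w hR)).hasDerivAt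
  -- the limit of the quotient of distances
  set A : CHat → ℝ := fun q => (chordal (f q) e' * chordal (f z) e' / chartFactor e') *
    (chartFactor e / (chordal q e * chordal z e)) with hA
  have hlim : Tendsto (fun q => ‖slope F w (chart e q)‖ * A q) (𝓝[≠] z) (𝓝 (‖deriv F w‖ * A z)) := by
    have h1 : Tendsto (chart e) (𝓝[≠] z) (𝓝[≠] w) := by
      refine tendsto_nhdsWithin_iff.2 ⟨(continuousAt_chart (hne z hz)).mono_left nhdsWithin_le_nhds, ?_⟩
      filter_upwards [self_mem_nhdsWithin, mem_nhdsWithin_of_mem_nhds (hU.mem_nhds hz)] with q hq hqU h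
      refine hq ?_
      have := congrArg (unchart e) h
      rwa [unchart_chart (hne q hqU), huw] at this
    refine ((hFder.tendsto_slope.comp h1).norm).mul (Tendsto.mono_left ?_ nhdsWithin_le_nhds)
    have h2 : ContinuousAt (fun q => chordal (f q) e') z :=
      ContinuousAt.comp (continuous_chordal_left e').continuousAt (hcont z hz)
    have h3 : ContinuousAt (fun q => chordal q e) z := (continuous_chordal_left e).continuousAt
    exact ((h2.mul_const _).div_const _).mul (continuousAt_const.div (h3.mul_const _) (by positivity))
  -- Koebe's estimate with the omitted value `chart e' b` is rewritten in chordal terms. The factor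
  -- is 48 = 24 · 2, the 2 coming from R; then 48 · 2 · (2/c)² = 384/c².
  have hbound : ‖deriv F w‖ * A z ≤ 384 / c ^ 2 * (bdist V (f z) / bdist U z) := by
    have h1 := norm_chart_sub hbne (hne' _ (hf hz))
    rw [chordal_comm b (f z), ← hbd] at h1
    rw [hFw] at hkoebe
    have h2 : ‖chart e' b - chart e' (f z)‖ =
        chartFactor e' * bdist V (f z) / (chordal b e' * chordal (f z) e') := by
      rw [eq_div_iff (by positivity), h1]
    rw [h2] at hkoebe
    have h3 : ‖deriv F w‖ ≤
        24 * (chartFactor e' * bdist V (f z) / (chordal b e' * chordal (f z) e')) / R := by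
      rw [le_div_iff₀ hR, mul_comm]; exact hkoebe
    have hA0 : 0 ≤ A z := by simp only [hA]; positivity
    refine (mul_le_mul_of_nonneg_right h3 hA0).trans ?_
    have h4 : 24 * (chartFactor e' * bdist V (f z) / (chordal b e' * chordal (f z) e')) / R * A z =
        48 * (chordal (f z) e' * (chordal z e)⁻¹ * (chordal b e')⁻¹) * (bdist V (f z) / bdist U z) := by
      simp only [hA, hRdef]
      field_simp
      ring
    rw [h4]
    refine mul_le_mul_of_nonneg_right ?_ (by positivity)
    have h5 : (chordal z e)⁻¹ ≤ 2 / c := by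
      rw [inv_le_comm₀ hχ (by positivity), inv_div]; exact hze
    have h6 : (chordal b e')⁻¹ ≤ 2 / c := by
      rw [inv_le_comm₀ hχb (by positivity), inv_div]; exact hbe'
    calc 48 * (chordal (f z) e' * (chordal z e)⁻¹ * (chordal b e')⁻¹)
        ≤ 48 * (2 * (2 / c) * (2 / c)) := by
          gcongr
          exact chordal_le_two _ _
      _ = 384 / c ^ 2 := by field_simp; norm_num
  have hev := hlim.eventually (gt_mem_nhds (show ‖deriv F w‖ * A z < 384 / c ^ 2 * (bdist V (f z) / bdist U z) + ε by linarith))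
  rw [eventually_nhdsWithin_iff] at hev
  filter_upwards [hev, hU.mem_nhds hz] with q hq hqU
  by_cases hqz : q = z
  · rw [hqz, chordal_self, chordal_self, mul_zero]
  · have h1 := hq hqz
    have hχq := chordal_pos (hne q hqU)
    have hχq' := chordal_pos (hne' _ (hf hqU))
    have hqz' := chordal_pos hqz
    have e1 := norm_chart_sub (hne q hqU) (hne z hz)
    have e2 := norm_chart_sub (hne' _ (hf hqU)) (hne' _ (hf hz))
    have e3 : ‖slope F w (chart e q)‖ = ‖chart e' (f q) - chart e' (f z)‖ / ‖chart e q - chart e z‖ := by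
      rw [slope_def_module, norm_smul, norm_inv, hFw]
      simp only [hF, unchart_chart (hne q hqU)]
      rw [mul_comm, div_eq_mul_inv]
    have hpos : 0 < ‖chart e q - chart e z‖ := by
      refine pos_of_mul_pos_left (b := chordal q e * chordal z e) ?_ (by positivity)
      rw [e1]; positivity
    have e4 : ‖slope F w (chart e q)‖ * A q * chordal q z = chordal (f q) (f z) := by
      have e1' : chordal q z = ‖chart e q - chart e z‖ * (chordal q e * chordal z e) / chartFactor e := by
        rw [eq_div_iff hK.ne', e1]; ring
      have e2' : chordal (f q) (f z) = ‖chart e' (f q) - chart e' (f z)‖ * (chordal (f q) e' * chordal (f z) e') / chartFactor e' := by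
        rw [eq_div_iff hK'.ne', e2]; ring
      rw [e3, e1', e2']
      simp only [hA]
      field_simp
    rw [← e4]
    exact mul_le_mul_of_nonneg_right h1.le hqz'.le

/-- A continuous map with bounded pointwise dilatation maps Lipschitz paths to Lipschitz paths. -/
theorem IsLipPath.comp {U V : Set CHat} {f : CHat → CHat} {γ : ℝ → CHat} {Λ : CHat → ℝ} {a b B : ℝ}
    (hγ : IsLipPath U γ a b) (hf : MapsTo f U V) (hcont : ∀ p ∈ U, ContinuousAt f p)
    (hB0 : 0 ≤ B) (hB : ∀ t ∈ Icc a b, Λ (γ t) ≤ B)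
    (hΛ : ∀ z ∈ U, ∀ ε > 0, ∀ᶠ q in 𝓝 z, chordal (f q) (f z) ≤ (Λ z + ε) * chordal q z) :
    IsLipPath V (fun t => f (γ t)) a b := by
  obtain ⟨K, hK0, hK⟩ := hγ.exists_pos
  refine ⟨fun t ht => hf (hγ.1 t ht), K * B, ?_⟩
  have hle : ∀ s ∈ Icc a b, ∀ t ∈ Icc a b, s ≤ t → chordal (f (γ t)) (f (γ s)) ≤ K * B * (t - s) := by
    intro s hs t ht hst
    have hsub : Icc s t ⊆ Icc a b := Icc_subset_Icc hs.1 ht.2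
    have hcf : ContinuousOn (fun r => f (γ r)) (Icc a b) := fun r hr =>
      (hcont _ (hγ.1 r hr)).comp_continuousWithinAt (hγ.continuousOn r hr)
    -- A mean value inequality: the distance to the starting point grows from the right at rate at
    -- most K B.
    have := image_le_of_liminf_slope_right_le_deriv_boundary
      (f := fun r => chordal (f (γ r)) (f (γ s))) (a := s) (b := t) (B := fun r => K * B * (r - s))
      (B' := fun _ => K * B)
      ((continuous_chordal_left _).comp_continuousOn (hcf.mono hsub)) (by simp [chordal_self])
      (by fun_prop) (fun r _ => by
        simpa using (((hasDerivAt_id r).sub_const s).const_mul (K * B)).hasDerivWithinAt)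
      (fun r hr R hR => ?_) (right_mem_Icc.2 hst)
    · exact this
    have hrab : r ∈ Icc a b := hsub (Ico_subset_Icc_self hr)
    -- This makes K (B + ε) the midpoint of K B and R, hence strictly less than R.
    set ε := (R - K * B) / (2 * K) with hε
    have hε0 : 0 < ε := by have := sub_pos.2 hR; positivity
    have hγr : Tendsto γ (𝓝[>] r) (𝓝 (γ r)) := by
      refine (hγ.continuousOn r hrab).mono_left ?_
      rw [← nhdsWithin_Ioo_eq_nhdsGT hr.2]
      exact nhdsWithin_mono _ fun x hx => ⟨hrab.1.trans hx.1.le, hx.2.le.trans ht.2⟩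
    refine Eventually.frequently ?_
    filter_upwards [hγr.eventually (hΛ _ (hγ.1 r hrab) ε hε0), self_mem_nhdsWithin,
      Ioo_mem_nhdsGT hr.2] with x hx1 hx2 hx3
    have hxr : 0 < x - r := sub_pos.2 hx2
    have hxab : x ∈ Icc a b := ⟨hrab.1.trans hx3.1.le, hx3.2.le.trans ht.2⟩
    rw [slope_def_field, div_lt_iff₀ hxr]
    have h1 := hK x hxab r hrab
    rw [abs_of_pos hxr] at h1
    have h2 := abs_chordal_sub_le (f (γ x)) (f (γ r)) (f (γ s))
    have h3 : chordal (f (γ x)) (f (γ r)) ≤ (B + ε) * chordal (γ x) (γ r) :=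
      hx1.trans (mul_le_mul_of_nonneg_right (by linarith [hB r hrab]) (chordal_nonneg _ _))
    have e1 : K * (B + ε) = (R + K * B) / 2 := by
      rw [hε]; field_simp; ring
    calc chordal (f (γ x)) (f (γ s)) - chordal (f (γ r)) (f (γ s))
        ≤ (B + ε) * chordal (γ x) (γ r) := (le_abs_self _).trans (h2.trans h3)
      _ ≤ (B + ε) * (K * (x - r)) := by gcongr
      _ = (R + K * B) / 2 * (x - r) := by rw [← e1]; ring
      _ < R * (x - r) := by gcongr; linarith
  intro s hs t ht
  rcases le_total s t with h | h
  · rw [abs_sub_comm, abs_of_nonneg (sub_nonneg.2 h), chordal_comm]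
    exact hle s hs t ht h
  · rw [abs_of_nonneg (sub_nonneg.2 h)]
    exact hle t ht s hs h

/-- A map whose dilatation is controlled by the distances to the boundaries
is Lipschitz for the quasihyperbolic metrics. -/
theorem qhEDist_map_le {U V : Set CHat} {f : CHat → CHat} {C : ℝ} (hC : 0 < C)
    (hU : IsOpen U) (hV : IsOpen V) (hUf : (frontier U).Nonempty) (hVf : (frontier V).Nonempty)
    (hf : MapsTo f U V) (hcont : ∀ p ∈ U, ContinuousAt f p)
    (h : ∀ z ∈ U, ∀ ε > 0, ∀ᶠ q in 𝓝 z, chordal (f q) (f z) ≤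
      (C * (bdist V (f z) / bdist U z) + ε) * chordal q z) (x y : CHat) :
    qhEDist V (f x) (f y) ≤ ENNReal.ofReal (16 * C) * qhEDist U x y := by
  simp only [qhEDist_eq]
  conv_rhs => rw [pathInf]
  have hL0 : ENNReal.ofReal (16 * C) ≠ 0 := by simpa using hC
  simp_rw [ENNReal.mul_iInf_of_ne hL0 ENNReal.ofReal_ne_top]
  refine le_iInf₂ fun γ hγ => ?_
  obtain ⟨h0, h1, hlip⟩ := isRectifiablePath_iff.1 hγ
  have hDpos : ∀ t ∈ Icc (0 : ℝ) 1, 0 < bdist U (γ t) := fun t ht => bdist_pos hU hUf (hlip.1 t ht)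
  -- By compactness the path keeps a positive distance from the boundary, so the dilatation of f is
  -- bounded along it and the image path is again Lipschitz.
  obtain ⟨t₀, ht₀, hmin⟩ := isCompact_Icc.exists_isMinOn (nonempty_Icc.2 zero_le_one)
    ((continuous_bdist U).comp_continuousOn hlip.continuousOn)
  have hlip' : IsLipPath V (fun t => f (γ t)) 0 1 := by
    refine hlip.comp (Λ := fun p => C * (bdist V (f p) / bdist U p)) (B := C * (2 / bdist U (γ t₀)))
      hf hcont (by have := hDpos t₀ ht₀; positivity) (fun t ht => ?_) h
    have := hDpos t₀ ht₀
    have h2 : bdist U (γ t₀) ≤ bdist U (γ t) := hmin ht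
    have h3 := bdist_le_two hVf (f (γ t))
    gcongr
  have h2 := pathInf_le (ρ := qhDensity V) zero_lt_one hlip'
  simp only [h0, h1] at h2
  refine h2.trans ?_
  rw [arcIntegral_eq_Ioo, show lineIntegral (qhDensity U) γ = arcIntegral (qhDensity U) γ 0 1 from rfl,
    arcIntegral_eq_Ioo, ← lintegral_const_mul' _ _ ENNReal.ofReal_ne_top]
  refine lintegral_mono_ae ?_
  filter_upwards [ae_differentiableAt_coordAt hlip, ae_restrict_mem measurableSet_Ioo] with t hdt ht
  have htI := Ioo_subset_Icc_self ht
  have hzU := hlip.1 t htI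
  set z := γ t with hz
  have hD := bdist_pos hU hUf hzU
  have hD' := bdist_pos hV hVf (hf hzU)
  set Λ := C * (bdist V (f z) / bdist U z) with hΛ
  have hΛ0 : 0 ≤ Λ := by positivity
  have hspeed : sphericalSpeed (fun t => f (γ t)) t ≤ Λ * sphericalSpeed γ t := by
    by_cases hdf : DifferentiableAt ℝ (fun s => coordAt (f (γ t)) (f (γ s))) t
    · have h3 := tendsto_chordal_div (hlip.continuousAt ht) hdt
      have h4 := tendsto_chordal_div (γ := fun s => f (γ s)) (hlip'.continuousAt ht) hdf
      have h5 : ∀ ε > 0, sphericalSpeed (fun t => f (γ t)) t ≤ (Λ + ε) * sphericalSpeed γ t := by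
        intro ε hε
        refine le_of_tendsto_of_tendsto h4 (h3.const_mul (Λ + ε)) ?_
        have h6 := (hlip.continuousAt ht).eventually (h z hzU ε hε)
        filter_upwards [h6.filter_mono nhdsWithin_le_nhds] with s hs
        rw [← mul_div_assoc]
        gcongr
      have h7 : Tendsto (fun ε : ℝ => (Λ + ε) * sphericalSpeed γ t) (𝓝[>] 0)
          (𝓝 ((Λ + 0) * sphericalSpeed γ t)) :=
        (Continuous.tendsto (by fun_prop) 0).mono_left nhdsWithin_le_nhds
      rw [add_zero] at h7
      exact ge_of_tendsto h7 (by filter_upwards [self_mem_nhdsWithin] with ε hε using h5 ε hε)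
    · rw [sphericalSpeed_eq_zero hdf]
      exact mul_nonneg hΛ0 (sphericalSpeed_nonneg _ _)
  have hs0 := sphericalSpeed_nonneg γ t
  -- The boundary distance of f z in the dilatation cancels the density of V. The factor 16 is the
  -- loss in comparing the density of U with the chordal one.
  calc qhDensity V (f z) * ENNReal.ofReal (sphericalSpeed (fun t => f (γ t)) t)
      ≤ ENNReal.ofReal (bdist V (f z))⁻¹ * ENNReal.ofReal (Λ * sphericalSpeed γ t) :=
        mul_le_mul' (qhDensity_le hD') (ENNReal.ofReal_le_ofReal hspeed)
    _ = ENNReal.ofReal (16 * C) * (ENNReal.ofReal (16 * bdist U z)⁻¹ * ENNReal.ofReal (sphericalSpeed γ t)) := by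
        rw [← ENNReal.ofReal_mul (by positivity), ← ENNReal.ofReal_mul (by positivity),
          ← ENNReal.ofReal_mul (by positivity)]
        congr 1
        rw [hΛ]
        field_simp
    _ ≤ _ := by
        gcongr
        exact le_qhDensity hUf hD

/-- `f` is holomorphic in all coordinates with pole outside the domain or range. -/
def ChartHolomorphicOn (f : CHat → CHat) (U V : Set CHat) : Prop :=
  (∀ p ∈ U, ContinuousAt f p) ∧ ∀ e ∈ Uᶜ, ∀ e' ∈ Vᶜ, ∀ w, unchart e w ∈ U →
    DifferentiableAt ℂ (fun v => chart e' (f (unchart e v))) w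

theorem IsConformalMap.chartHolomorphicOn {f : CHat → CHat} {U V : Set CHat}
    (h : IsConformalMap f U V) : ChartHolomorphicOn f U V :=
  ⟨fun p hp => (h.2 p hp).1, fun _ _ _ he' _ hw => (h.2 _ hw).differentiableAt_chart
    fun h' => he' (h' ▸ h.1.mapsTo hw)⟩

theorem ChartHolomorphicOn.symm {f g : CHat → CHat} {U V : Set CHat} (hU : IsOpen U) (hV : IsOpen V)
    (hUc : Uᶜ.Nonempty) (hVc : Vᶜ.Nonempty)
    (hf : BijOn f U V) (hg : MapsTo g V U) (hgf : ∀ p ∈ U, g (f p) = p) (hfg : ∀ q ∈ V, f (g q) = q)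
    (h : ChartHolomorphicOn f U V) : ChartHolomorphicOn g V U := by
  have key : ∀ e ∈ Uᶜ, ∀ e' ∈ Vᶜ, ∀ w, unchart e' w ∈ V →
      DifferentiableAt ℂ (fun v => chart e (g (unchart e' v))) w := by
    intro e he e' he' w hw
    have hne : ∀ p ∈ U, p ≠ e := fun p hp h => he (h ▸ hp)
    have hne' : ∀ p ∈ V, p ≠ e' := fun p hp h => he' (h ▸ hp)
    have hW : IsOpen (unchart e ⁻¹' U) := hU.preimage (continuous_unchart e)
    have hleft : ∀ v ∈ unchart e ⁻¹' U, chart e (g (unchart e' (chart e' (f (unchart e v))))) = v := by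
      intro v hv
      rw [unchart_chart (hne' _ (hf.mapsTo hv)), hgf _ hv, chart_unchart]
    have hv₀ : chart e (g (unchart e' w)) ∈ unchart e ⁻¹' U := by
      rw [mem_preimage, unchart_chart (hne _ (hg hw))]; exact hg hw
    have := differentiableAt_of_leftInverse (F := fun v => chart e' (f (unchart e v)))
      (G := fun v => chart e (g (unchart e' v))) hW
      -- In a pair of coordinates with poles off U and V, the inverse map is the left inverse of a
      -- univalent function on a plane open set.
      (fun v hv => (h.2 e he e' he' v hv).differentiableWithinAt)
      (fun v hv v' hv' hvv => by rw [← hleft v hv, ← hleft v' hv']; simp only [] at hvv; rw [hvv]) hleft hv₀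
    simpa only [unchart_chart (hne _ (hg hw)), hfg _ hw, chart_unchart] using this
  refine ⟨fun q hq => ?_, fun e' he' e he => key e he e' he'⟩
  obtain ⟨e, he⟩ := hUc
  obtain ⟨e', he'⟩ := hVc
  have hne : ∀ p ∈ U, p ≠ e := fun p hp h => he (h ▸ hp)
  have hne' : ∀ p ∈ V, p ≠ e' := fun p hp h => he' (h ▸ hp)
  have h1 := (key e he e' he' (chart e' q) (by rwa [unchart_chart (hne' q hq)])).continuousAt
  have h2 : ContinuousAt (fun p => unchart e (chart e (g (unchart e' (chart e' p))))) q :=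
    (continuous_unchart e).continuousAt.comp (ContinuousAt.comp (f := chart e') h1 (continuousAt_chart (hne' q hq)))
  refine h2.congr ?_
  filter_upwards [hV.mem_nhds hq] with p hp
  rw [unchart_chart (hne' p hp), unchart_chart (hne _ (hg hp))]

/-- The dilatation bound of `eventually_chordal_map_le` integrated along paths. -/
theorem ChartHolomorphicOn.qhEDist_map_le {U V : Set CHat} {f : CHat → CHat} {c : ℝ} (hc : 0 < c)
    (hU : IsOpen U) (hV : IsOpen V) (hUf : (frontier U).Nonempty) (hVf : (frontier V).Nonempty)
    (hUc : ∃ p ∈ Uᶜ, ∃ q ∈ Uᶜ, c ≤ chordal p q) (hVc : ∃ p ∈ Vᶜ, ∃ q ∈ Vᶜ, c ≤ chordal p q)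
    (h : ChartHolomorphicOn f U V) (hf : MapsTo f U V) (hinj : InjOn f U) (x y : CHat) :
    qhEDist V (f x) (f y) ≤ ENNReal.ofReal (16 * (384 / c ^ 2)) * qhEDist U x y :=
  SphericalQH.qhEDist_map_le (by positivity) hU hV hUf hVf hf h.1
    (fun _ hz _ hε => eventually_chordal_map_le hc hU hV hVf hUf hUc hVc hf hinj h.2 h.1 hz hε) x y

/-- Conformal maps are bi-Lipschitz for the quasihyperbolic metrics. -/
theorem IsConformalMap.isBiLipschitzOn {a : ℝ} (ha : 0 < a) {U V : Set CHat} {f : CHat → CHat}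
    (hU : IsDomainOfSphere U) (hV : IsDomainOfSphere V)
    (hUa : ENNReal.ofReal a ≤ sphericalDiam Uᶜ) (hVa : ENNReal.ofReal a ≤ sphericalDiam Vᶜ)
    (hf : IsConformalMap f U V) {L : ℝ} (hL : 16 * (384 / (a / 32) ^ 2) ≤ L) :
    IsBiLipschitzOn L (qhDist U) (qhDist V) f U := by
  have hUc := exists_chordal_ge ha hUa
  have hVc := exists_chordal_ge ha hVa
  have hUne : Uᶜ.Nonempty := ⟨_, hUc.choose_spec.1⟩
  have hVne : Vᶜ.Nonempty := ⟨_, hVc.choose_spec.1⟩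
  have hUf := frontier_nonempty hU.2 hUne
  have hVf := frontier_nonempty hV.2 hVne
  have hc : 0 < a / 32 := by positivity
  have hL0 : 0 < L := lt_of_lt_of_le (by positivity) hL
  set g := Function.invFunOn f U
  have hgf : ∀ p ∈ U, g (f p) = p := fun p hp => hf.1.injOn.leftInvOn_invFunOn hp
  have hfg : ∀ q ∈ V, f (g q) = q := fun q hq => hf.1.surjOn.rightInvOn_invFunOn hq
  have hg : MapsTo g V U := hf.1.surjOn.mapsTo_invFunOn
  have hginj : InjOn g V := fun p hp q hq h => by rw [← hfg p hp, h, hfg q hq]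
  have hfh := hf.chartHolomorphicOn
  have hgh := hfh.symm hU.1 hV.1 hUne hVne hf.1 hg hgf hfg
  have hLL : ENNReal.ofReal (16 * (384 / (a / 32) ^ 2)) ≤ ENNReal.ofReal L := ENNReal.ofReal_le_ofReal hL
  -- The real-valued distance sends ∞ to 0, so an inequality in one direction alone would not
  -- survive the passage to reals. The two together force both distances to be infinite or neither.
  have hmul : ∀ s t : ℝ≥0∞, t ≤ ENNReal.ofReal L * s → s ≤ ENNReal.ofReal L * t →
      t.toReal ≤ L * s.toReal := by
    intro s t h1 h2
    by_cases hs : s = ⊤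
    · have ht : t = ⊤ := by
        by_contra ht
        rw [hs, top_le_iff] at h2
        exact ENNReal.mul_ne_top ENNReal.ofReal_ne_top ht h2
      simp [hs, ht]
    · have := ENNReal.toReal_mono (ENNReal.mul_ne_top ENNReal.ofReal_ne_top hs) h1
      rwa [ENNReal.toReal_mul, ENNReal.toReal_ofReal hL0.le] at this
  intro x hx y hy
  have h1 : qhEDist V (f x) (f y) ≤ ENNReal.ofReal L * qhEDist U x y :=
    (hfh.qhEDist_map_le hc hU.1 hV.1 hUf hVf hUc hVc hf.1.mapsTo hf.1.injOn x y).trans (by gcongr)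
  have h2 : qhEDist U x y ≤ ENNReal.ofReal L * qhEDist V (f x) (f y) := by
    have := (hgh.qhEDist_map_le hc hV.1 hU.1 hVf hUf hVc hUc hg hginj (f x) (f y)).trans
      (mul_le_mul_left hLL _)
    rwa [hgf x hx, hgf y hy] at this
  refine ⟨?_, hmul _ _ h1 h2⟩
  rw [inv_mul_le_iff₀ hL0]
  exact hmul _ _ h2 h1

/-! ### The quasihyperbolic metric is a geodesic metric -/

/-- In a coordinate disc about p where the boundary distance exceeds half its value at p, the
density is bounded and the straight segment is a short path. -/
theorem tendsto_qhEDist {Ω : Set CHat} (hΩ : IsOpen Ω) (hfr : (frontier Ω).Nonempty) {p : CHat}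
    (hp : p ∈ Ω) : Tendsto (qhEDist Ω p) (𝓝 p) (𝓝 0) := by
  obtain ⟨e, hpe, -⟩ := exists_far_point p p
  have hne := ne_of_half_le hpe
  have hD := bdist_pos hΩ hfr hp
  set S : Set CHat := Ω ∩ {q | bdist Ω p / 2 < bdist Ω q} with hS
  have hSo : IsOpen S := hΩ.inter (isOpen_lt continuous_const (continuous_bdist Ω))
  have hpS : unchart e (chart e p) ∈ S := by
    rw [unchart_chart hne]; exact ⟨hp, half_lt_self hD⟩
  obtain ⟨r, hr, hball⟩ := Metric.isOpen_iff.1 (hSo.preimage (continuous_unchart e)) _ hpS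
  have hlim : Tendsto (fun q => ENNReal.ofReal (bdist Ω p / 2)⁻¹ *
      ENNReal.ofReal (4 / chartFactor e * ‖chart e p - chart e q‖)) (𝓝 p) (𝓝 0) := by
    have h1 : Tendsto (fun q => 4 / chartFactor e * ‖chart e p - chart e q‖) (𝓝 p)
        (𝓝 (4 / chartFactor e * ‖chart e p - chart e p‖)) :=
      (((continuousAt_chart hne).const_sub _).norm).const_mul _
    rw [sub_self, norm_zero, mul_zero] at h1
    have h2 := ENNReal.Tendsto.const_mul (a := ENNReal.ofReal (bdist Ω p / 2)⁻¹)
      (ENNReal.tendsto_ofReal h1) (Or.inr ENNReal.ofReal_ne_top)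
    simpa using h2
  refine tendsto_of_tendsto_of_tendsto_of_le_of_le' tendsto_const_nhds hlim (.of_forall fun _ => bot_le) ?_
  filter_upwards [(continuousAt_chart hne).eventually (Metric.ball_mem_nhds _ hr), isOpen_ne.mem_nhds hne]
    with q hq hqe
  refine pathInf_le_of_segment hne hqe fun w hw => ?_
  have hwS : unchart e w ∈ S :=
    hball ((convex_ball _ _).segment_subset (Metric.mem_ball_self hr) hq hw)
  refine ⟨hwS.1, (qhDensity_le (by linarith [hwS.2.out])).trans (ENNReal.ofReal_le_ofReal ?_)⟩
  have := hwS.2.out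
  gcongr

/-- Finite distance is an equivalence relation that holds locally, hence everywhere on a connected
set. -/
theorem qhEDist_ne_top {Ω : Set CHat} (hΩ : IsDomainOfSphere Ω) (hfr : (frontier Ω).Nonempty)
    {x y : CHat} (hx : x ∈ Ω) (hy : y ∈ Ω) : qhEDist Ω x y ≠ ⊤ := by
  refine hΩ.2.isPreconnected.induction₂ (fun x y => qhEDist Ω x y ≠ ⊤) (fun p hp => ?_)
    (fun x y z _ _ _ h1 h2 => ?_) (fun x y _ _ h => ?_) hx hy
  · filter_upwards [((tendsto_qhEDist hΩ.1 hfr hp).eventually (gt_mem_nhds one_pos)).filter_mono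
      nhdsWithin_le_nhds] with q hq using (hq.trans ENNReal.one_lt_top).ne
  · exact ne_top_of_le_ne_top (ENNReal.add_ne_top.2 ⟨h1, h2⟩) (pathInf_triangle _ _ _ _ _)
  · rwa [qhEDist_eq, pathInf_comm] at h

theorem qhDist_comm (Ω : Set CHat) (x y : CHat) : qhDist Ω x y = qhDist Ω y x := by
  rw [qhDist, qhDist, qhEDist_eq, qhEDist_eq, pathInf_comm]

theorem qhDist_self {Ω : Set CHat} {x : CHat} (hx : x ∈ Ω) : qhDist Ω x x = 0 := by
  rw [qhDist, qhEDist_eq, pathInf_self hx, ENNReal.toReal_zero]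

theorem qhDist_nonneg (Ω : Set CHat) (x y : CHat) : 0 ≤ qhDist Ω x y := ENNReal.toReal_nonneg

theorem qhDist_triangle {Ω : Set CHat} (hΩ : IsDomainOfSphere Ω) (hfr : (frontier Ω).Nonempty)
    {x y z : CHat} (hx : x ∈ Ω) (hy : y ∈ Ω) (hz : z ∈ Ω) :
    qhDist Ω x z ≤ qhDist Ω x y + qhDist Ω y z := by
  have h1 := qhEDist_ne_top hΩ hfr hx hy
  have h2 := qhEDist_ne_top hΩ hfr hy hz
  rw [qhDist, qhDist, qhDist, ← ENNReal.toReal_add h1 h2]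
  exact ENNReal.toReal_mono (ENNReal.add_ne_top.2 ⟨h1, h2⟩) (pathInf_triangle _ _ _ _ _)

theorem tendsto_qhDist {Ω : Set CHat} (hΩ : IsOpen Ω) (hfr : (frontier Ω).Nonempty) {p : CHat}
    (hp : p ∈ Ω) : Tendsto (qhDist Ω p) (𝓝 p) (𝓝 0) := by
  have := (ENNReal.tendsto_toReal ENNReal.zero_ne_top).comp (tendsto_qhEDist hΩ hfr hp)
  simpa [Function.comp_def, qhDist] using! this

/-- A function whose dilatation is at most `c / bdist` is Lipschitz for the quasihyperbolic metric. -/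
theorem sub_le_qhDist {Ω : Set CHat} (hΩ : IsDomainOfSphere Ω) (hfr : (frontier Ω).Nonempty)
    {φ : CHat → ℝ} {c : ℝ} (hc : 0 ≤ c)
    (hK : ∀ m > 0, ∃ K, ∀ p q, m ≤ bdist Ω p → m ≤ bdist Ω q → |φ p - φ q| ≤ K * chordal p q)
    (hφ : ∀ p ∈ Ω, ∀ q ∈ Ω, φ q - φ p ≤ c / bdist Ω p * chordal q p)
    {x y : CHat} (hx : x ∈ Ω) (hy : y ∈ Ω) :
    φ y - φ x ≤ 16 * c * qhDist Ω x y := by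
  have hkey : ENNReal.ofReal (φ y - φ x) ≤ ENNReal.ofReal (16 * c) * qhEDist Ω x y := by
    rw [qhEDist_eq, pathInf]
    rcases hc.eq_or_lt with rfl | hc
    · have := hφ x hx y hy
      simp only [zero_div, zero_mul] at this
      simp [ENNReal.ofReal_eq_zero.2 this]
    have hL0 : ENNReal.ofReal (16 * c) ≠ 0 := by simpa using hc
    simp_rw [ENNReal.mul_iInf_of_ne hL0 ENNReal.ofReal_ne_top]
    refine le_iInf₂ fun γ hγ => ?_
    obtain ⟨h0, h1, hlip⟩ := isRectifiablePath_iff.1 hγ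
    obtain ⟨t₀, ht₀, hmin⟩ := isCompact_Icc.exists_isMinOn (nonempty_Icc.2 zero_le_one)
      ((continuous_bdist Ω).comp_continuousOn hlip.continuousOn)
    -- Only a Lipschitz bound away from the boundary is required of φ, since a path stays at
    -- distance at least m from it. This admits φ = log d, d the boundary distance.
    obtain ⟨K, hK⟩ := hK _ (bdist_pos hΩ.1 hfr (hlip.1 t₀ ht₀))
    obtain ⟨K', hK0', hK'⟩ := hlip.exists_pos
    have h2 := ofReal_sub_le_arcIntegral (φ := φ) (G := fun p => c / bdist Ω p) (K := |K| * K') zero_le_one hlip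
      (fun p hp => by have := bdist_nonneg Ω p; positivity) (fun s hs t ht => ?_) hφ
    · rw [h0, h1] at h2
      refine h2.trans ?_
      rw [show lineIntegral (qhDensity Ω) γ = arcIntegral (qhDensity Ω) γ 0 1 from rfl, arcIntegral,
        arcIntegral, ← lintegral_const_mul' _ _ ENNReal.ofReal_ne_top]
      refine setLIntegral_mono' measurableSet_Icc fun t ht => ?_
      rw [← mul_assoc]
      gcongr
      have hD := bdist_pos hΩ.1 hfr (hlip.1 t ht)
      have h3 := le_qhDensity hfr hD
      calc ENNReal.ofReal (c / bdist Ω (γ t)) = ENNReal.ofReal (16 * c) * ENNReal.ofReal (16 * bdist Ω (γ t))⁻¹ := by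
            rw [← ENNReal.ofReal_mul (by positivity)]
            congr 1
            field_simp
        _ ≤ _ := by gcongr
    · refine (hK _ _ (hmin hs) (hmin ht)).trans ?_
      rw [mul_assoc]
      exact mul_le_mul (le_abs_self K) (hK' s hs t ht) (chordal_nonneg _ _) (abs_nonneg K)
  have hfin := qhEDist_ne_top hΩ hfr hx hy
  have h3 := ENNReal.toReal_mono (ENNReal.mul_ne_top ENNReal.ofReal_ne_top hfin) hkey
  rw [ENNReal.toReal_mul, ENNReal.toReal_ofReal (mul_nonneg (by norm_num) hc)] at h3
  exact (le_max_left _ 0).trans (ENNReal.toReal_ofReal'.symm.le.trans h3)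

theorem chordal_le_qhDist {Ω : Set CHat} (hΩ : IsDomainOfSphere Ω) (hfr : (frontier Ω).Nonempty)
    {x y : CHat} (hx : x ∈ Ω) (hy : y ∈ Ω) : chordal x y ≤ 32 * qhDist Ω x y := by
  have := sub_le_qhDist hΩ hfr (φ := fun q => chordal q x) (c := 2) zero_le_two
    (fun m _ => ⟨1, fun p q _ _ => by rw [one_mul]; exact abs_chordal_sub_le _ _ _⟩)
    (fun p hp q _ => ?_) hx hy
  · rw [chordal_self, sub_zero, chordal_comm] at this
    linarith
  · have hD := bdist_pos hΩ.1 hfr hp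
    have h1 : 1 ≤ 2 / bdist Ω p := by
      rw [le_div_iff₀ hD]; linarith [bdist_le_two hfr p]
    have h2 := chordal_triangle q p x
    nlinarith [chordal_nonneg q p]

/-- Points at bounded quasihyperbolic distance from x keep a definite distance from the boundary.
This confines limits of almost geodesics to Ω. -/
theorem log_bdist_le {Ω : Set CHat} (hΩ : IsDomainOfSphere Ω) (hfr : (frontier Ω).Nonempty)
    {x y : CHat} (hx : x ∈ Ω) (hy : y ∈ Ω) :
    Real.log (bdist Ω x) - Real.log (bdist Ω y) ≤ 16 * qhDist Ω x y := by
  have hlog : ∀ s t : ℝ, 0 < s → 0 < t → Real.log s - Real.log t ≤ (s - t) / t := by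
    intro s t hs ht
    rw [← Real.log_div hs.ne' ht.ne']
    refine (Real.log_le_sub_one_of_pos (by positivity)).trans (le_of_eq ?_)
    field_simp
  have := sub_le_qhDist hΩ hfr (φ := fun q => Real.log (bdist Ω q)) (c := 1) zero_le_one
    (fun m hm => ⟨m⁻¹, fun p q hp hq => ?_⟩) (fun p hp q hq => ?_) hy hx
  · rw [qhDist_comm] at this
    linarith
  · have key : ∀ p q, m ≤ bdist Ω p → m ≤ bdist Ω q →
        Real.log (bdist Ω p) - Real.log (bdist Ω q) ≤ m⁻¹ * chordal p q := by
      intro p q hp hq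
      refine (hlog _ _ (by linarith) (by linarith)).trans ?_
      rw [div_le_iff₀ (by linarith)]
      have h1 := bdist_le_add Ω p q
      have h2 : 1 ≤ m⁻¹ * bdist Ω q := by
        rw [inv_mul_eq_div, le_div_iff₀ hm]; linarith
      nlinarith [chordal_nonneg p q]
    rw [abs_sub_le_iff]
    exact ⟨key p q hp hq, by rw [chordal_comm]; exact key q p hq hp⟩
  · have h1 := bdist_pos hΩ.1 hfr hp
    refine (hlog _ _ (bdist_pos hΩ.1 hfr hq) h1).trans ?_
    rw [div_mul_eq_mul_div, one_mul]
    gcongr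
    linarith [bdist_le_add Ω q p]

/-- Approximate geodesics, not necessarily continuous. -/
theorem exists_almost_geodesic {Ω : Set CHat} (hΩ : IsDomainOfSphere Ω) (hfr : (frontier Ω).Nonempty)
    {x y : CHat} (hx : x ∈ Ω) (hy : y ∈ Ω) (hD : 0 < qhDist Ω x y) {ε : ℝ} (hε : 0 < ε) :
    ∃ g : ℝ → CHat, (∀ t, g t ∈ Ω) ∧ g 0 = x ∧ g (qhDist Ω x y) = y ∧
      ∀ s ∈ Icc 0 (qhDist Ω x y), ∀ t ∈ Icc 0 (qhDist Ω x y), qhDist Ω (g s) (g t) ≤ |s - t| + ε := by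
  set D := qhDist Ω x y with hDdef
  have hfin := qhEDist_ne_top hΩ hfr hx hy
  have hlt : qhEDist Ω x y < ENNReal.ofReal (D + ε) := by
    rw [← ENNReal.ofReal_toReal hfin]
    exact (ENNReal.ofReal_lt_ofReal_iff (by positivity)).2 (lt_add_of_pos_right _ hε)
  rw [qhEDist_eq, pathInf] at hlt
  simp only [iInf_lt_iff] at hlt
  obtain ⟨γ, hγ, hlen⟩ := hlt
  obtain ⟨h0, h1, hlip⟩ := isRectifiablePath_iff.1 hγ
  set I := arcIntegral (qhDensity Ω) γ with hI
  have hlen1 : I 0 1 < ENNReal.ofReal (D + ε) := hlen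
  obtain ⟨t₀, ht₀, hmin⟩ := isCompact_Icc.exists_isMinOn (nonempty_Icc.2 zero_le_one)
    ((continuous_bdist Ω).comp_continuousOn hlip.continuousOn)
  have hm := bdist_pos hΩ.1 hfr (hlip.1 t₀ ht₀)
  obtain ⟨K, hK0, hK⟩ := hlip.exists_pos
  have hbd : ∀ s t, 0 ≤ s → s ≤ t → t ≤ 1 →
      I s t ≤ ENNReal.ofReal ((bdist Ω (γ t₀))⁻¹ * K * (t - s)) := by
    intro s t hs hst ht
    have hsub : Icc s t ⊆ Icc 0 1 := Icc_subset_Icc hs ht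
    rw [ENNReal.ofReal_mul (by positivity), ENNReal.ofReal_mul (by positivity)]
    refine arcIntegral_le_of_le hK0.le (fun r hr => hlip.1 r (hsub hr))
      (fun r hr r' hr' => hK r (hsub hr) r' (hsub hr')) fun r hr => ?_
    have h2 : bdist Ω (γ t₀) ≤ bdist Ω (γ r) := hmin (hsub hr)
    refine (qhDensity_le (by linarith)).trans (ENNReal.ofReal_le_ofReal ?_)
    gcongr
  have hIfin : ∀ s t, 0 ≤ s → s ≤ t → t ≤ 1 → I s t ≠ ⊤ := fun s t hs hst ht =>
    ne_top_of_le_ne_top ENNReal.ofReal_ne_top (hbd s t hs hst ht)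
  set l : ℝ → ℝ := fun t => (I 0 t).toReal with hl
  have hladd : ∀ s t, 0 ≤ s → s ≤ t → t ≤ 1 → l t - l s = (I s t).toReal := by
    intro s t hs hst ht
    have e1 : I 0 t = I 0 s + I s t :=
      le_antisymm (arcIntegral_le_add _ _ hs hst) (arcIntegral_add_le _ _ hs hst)
    simp only [hl]
    rw [e1, ENNReal.toReal_add (hIfin 0 s le_rfl hs (hst.trans ht)) (hIfin s t hs hst ht)]
    ring
  have hlcont : ContinuousOn l (Icc 0 1) := by
    have : LipschitzOnWith (Real.toNNReal ((bdist Ω (γ t₀))⁻¹ * K)) l (Icc 0 1) := by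
      refine LipschitzOnWith.of_le_add_mul _ fun s hs t ht => ?_
      rw [Real.coe_toNNReal _ (by positivity), Real.dist_eq]
      rcases le_total s t with h | h
      · have := hladd s t hs.1 h ht.2
        have h2 : 0 ≤ (I s t).toReal := ENNReal.toReal_nonneg
        have h3 : 0 ≤ (bdist Ω (γ t₀))⁻¹ * K * |s - t| := by positivity
        linarith
      · have h2 := hladd t s ht.1 h hs.2
        have h3 := ENNReal.toReal_mono ENNReal.ofReal_ne_top (hbd t s ht.1 h hs.2)
        rw [ENNReal.toReal_ofReal (by have := sub_nonneg.2 h; positivity)] at h3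
        rw [abs_of_nonneg (sub_nonneg.2 h)]
        linarith
    exact this.continuousOn
  have hl0 : l 0 = 0 := by
    have := hladd 0 0 le_rfl le_rfl zero_le_one
    have h2 : I 0 0 = 0 := by
      have := hbd 0 0 le_rfl le_rfl zero_le_one
      simpa using this
    simp [hl, h2]
  have hl1 : l 1 ≤ D + ε := by
    have := ENNReal.toReal_mono ENNReal.ofReal_ne_top hlen1.le
    rwa [ENNReal.toReal_ofReal (by positivity)] at this
  have hdist : ∀ s t, 0 ≤ s → s ≤ t → t ≤ 1 → qhDist Ω (γ s) (γ t) ≤ l t - l s := by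
    intro s t hs hst ht
    rcases hst.eq_or_lt with rfl | hst'
    · rw [qhDist_self (hlip.1 s ⟨hs, ht⟩), sub_self]
    · rw [hladd s t hs hst ht]
      exact ENNReal.toReal_mono (hIfin s t hs hst ht) (pathInf_le hst' (hlip.mono hs ht))
  have hl1' : D ≤ l 1 := by
    have := hdist 0 1 le_rfl zero_le_one le_rfl
    rwa [h0, h1, hl0, sub_zero] at this
  -- A time at which the length travelled is s, found by the intermediate value theorem. The
  -- endpoints are prescribed separately: the total length may exceed D by up to ε, yet g must end
  -- exactly at y.
  have hτ : ∀ s, ∃ τ ∈ Icc (0 : ℝ) 1, (s = 0 → τ = 0) ∧ (s = D → τ = 1) ∧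
      (s ∈ Icc 0 D → s ≤ l τ ∧ l τ ≤ s + ε) := by
    intro s
    by_cases hs0 : s = 0
    · exact ⟨0, by simp, fun _ => rfl, fun h => absurd (hs0.symm.trans h) hD.ne, fun _ => by
        rw [hl0, hs0]; exact ⟨le_rfl, by linarith⟩⟩
    by_cases hsD : s = D
    · exact ⟨1, by simp, fun h => absurd h hs0, fun _ => rfl, fun _ => by rw [hsD]; exact ⟨hl1', hl1⟩⟩
    by_cases hs : s ∈ Icc 0 D
    · obtain ⟨τ, hτ, hτs⟩ := intermediate_value_Icc zero_le_one hlcont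
        (show s ∈ Icc (l 0) (l 1) by rw [hl0]; exact ⟨hs.1, hs.2.trans hl1'⟩)
      exact ⟨τ, hτ, fun h => absurd h hs0, fun h => absurd h hsD, fun _ => by
        rw [hτs]; exact ⟨le_rfl, by linarith⟩⟩
    · exact ⟨0, by simp, fun h => absurd h hs0, fun h => absurd h hsD, fun h => absurd h hs⟩
  choose τ hτI hτ0 hτD hτl using hτ
  refine ⟨fun s => γ (τ s), fun s => hlip.1 _ (hτI s), by simp only [hτ0 0 rfl, h0], by simp only [hτD D rfl, h1],
    fun s hs t ht => ?_⟩
  obtain ⟨a1, a2⟩ := hτl s hs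
  obtain ⟨b1, b2⟩ := hτl t ht
  rcases le_total (τ s) (τ t) with h | h
  · have := hdist _ _ (hτI s).1 h (hτI t).2
    linarith [neg_abs_le (s - t)]
  · have := hdist _ _ (hτI t).1 h (hτI s).2
    rw [qhDist_comm]
    linarith [le_abs_self (s - t)]

/-- The quasihyperbolic metric is geodesic. -/
theorem exists_geodesic {Ω : Set CHat} (hΩ : IsDomainOfSphere Ω) (hfr : (frontier Ω).Nonempty)
    (x y : Ω) : ∃ S, IsGeodesicSegment (fun x y : Ω => qhDist Ω x y) x y S := by
  obtain ⟨x, hx⟩ := x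
  obtain ⟨y, hy⟩ := y
  set D := qhDist Ω x y with hDdef
  rcases (qhDist_nonneg Ω x y).eq_or_lt with hD0 | hDpos
  · have hxy : x = y := by
      have := chordal_le_qhDist hΩ hfr hx hy
      rw [← hD0, mul_zero] at this
      exact chordal_eq_zero.1 (le_antisymm this (chordal_nonneg _ _))
    subst hxy
    refine ⟨_, fun _ => ⟨x, hx⟩, rfl, rfl, fun s hs t ht => ?_, rfl⟩
    simp only [qhDist_self hx, Icc_self, mem_singleton_iff] at hs ht ⊢
    simp [hs, ht]
  choose G hGΩ hG0 hGD hG using fun n : ℕ =>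
    exists_almost_geodesic hΩ hfr hx hy hDpos (Nat.one_div_pos_of_nat (α := ℝ) (n := n))
  -- On the compact sphere, limits along an ultrafilter exist for all parameters at once. They
  -- replace the Arzelà–Ascoli theorem, so the almost geodesics need not be continuous.
  let F : Ultrafilter ℕ := hyperfilter ℕ
  have hF : Tendsto (fun n : ℕ => 1 / ((n : ℝ) + 1)) F (𝓝 0) :=
    tendsto_one_div_add_atTop_nhds_zero_nat.mono_left Nat.hyperfilter_le_atTop
  have hlim : ∀ t, ∃ p, t ∈ Icc 0 D → p ∈ Ω ∧ Tendsto (fun n => G n t) F (𝓝 p) := by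
    intro t
    refine ⟨(F.map fun n => G n t).lim, fun ht => ?_⟩
    set p := (F.map fun n => G n t).lim
    have hp : Tendsto (fun n => G n t) F (𝓝 p) := (F.map fun n => G n t).le_nhds_lim
    refine ⟨?_, hp⟩
    -- All the points G n t lie within D + 1 of x, so their boundary distances are bounded below
    -- uniformly in n.
    have hb : bdist Ω x * Real.exp (-(16 * (D + 1))) ≤ bdist Ω p := by
      refine ge_of_tendsto (((continuous_bdist Ω).tendsto p).comp hp) (.of_forall fun n => ?_)
      have h1 := log_bdist_le hΩ hfr hx (hGΩ n t)
      have h2 := hG n 0 ⟨le_rfl, hDpos.le⟩ t ht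
      rw [hG0 n, zero_sub, abs_neg, abs_of_nonneg ht.1] at h2
      have h3 : 1 / ((n : ℝ) + 1) ≤ 1 := by
        rw [div_le_one (by positivity)]; linarith [n.cast_nonneg (α := ℝ)]
      have h4 := ht.2
      have hbx := bdist_pos hΩ.1 hfr hx
      have hbg := bdist_pos hΩ.1 hfr (hGΩ n t)
      rw [Function.comp_apply, ← Real.log_le_log_iff (by positivity) hbg,
        Real.log_mul hbx.ne' (Real.exp_pos _).ne', Real.log_exp]
      linarith
    have hbpos : 0 < bdist Ω p := lt_of_lt_of_le (by have := bdist_pos hΩ.1 hfr hx; positivity) hb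
    by_contra hcon
    have hfrp : p ∈ frontier Ω := by
      rw [hΩ.1.frontier_eq]
      exact ⟨mem_closure_of_tendsto hp (.of_forall fun n => hGΩ n t), hcon⟩
    have := bdist_le hfrp (p := p)
    rw [chordal_self] at this
    linarith
  choose g hg using hlim
  have hgle : ∀ s ∈ Icc 0 D, ∀ t ∈ Icc 0 D, qhDist Ω (g s) (g t) ≤ |s - t| := by
    intro s hs t ht
    obtain ⟨hsΩ, hsl⟩ := hg s hs
    obtain ⟨htΩ, htl⟩ := hg t ht
    have h1 := (tendsto_qhDist hΩ.1 hfr hsΩ).comp hsl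
    have h2 := (tendsto_qhDist hΩ.1 hfr htΩ).comp htl
    have h3 := (h1.add ((tendsto_const_nhds (x := |s - t|)).add hF)).add h2
    rw [zero_add, add_zero, add_zero] at h3
    refine ge_of_tendsto h3 (.of_forall fun n => ?_)
    have a1 := qhDist_triangle hΩ hfr hsΩ (hGΩ n s) htΩ
    have a2 := qhDist_triangle hΩ hfr (hGΩ n s) (hGΩ n t) htΩ
    have a3 := hG n s hs t ht
    rw [qhDist_comm Ω (G n t)] at a2
    simp only [Function.comp_apply]
    linarith
  have h0D : (0 : ℝ) ∈ Icc 0 D := ⟨le_rfl, hDpos.le⟩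
  have hDD : D ∈ Icc 0 D := ⟨hDpos.le, le_rfl⟩
  have hg0 : g 0 = x := by
    have := (hg 0 h0D).2
    simp only [hG0] at this
    exact (tendsto_nhds_unique this tendsto_const_nhds)
  have hgD : g D = y := by
    have := (hg D hDD).2
    simp only [hDdef, hGD] at this
    exact (tendsto_nhds_unique this tendsto_const_nhds)
  -- The curve is 1-Lipschitz and its endpoints are at distance D, so by the triangle inequality no
  -- intermediate distance can be shorter than the parameter difference.
  have hge : ∀ s ∈ Icc 0 D, ∀ t ∈ Icc 0 D, s ≤ t → t - s ≤ qhDist Ω (g s) (g t) := by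
    intro s hs t ht _
    have h1 := hgle 0 h0D s hs
    have h2 := hgle t ht D hDD
    rw [hg0, zero_sub, abs_neg, abs_of_nonneg hs.1] at h1
    rw [hgD, abs_sub_comm, abs_of_nonneg (sub_nonneg.2 ht.2)] at h2
    have h3 := qhDist_triangle hΩ hfr hx (hg s hs).1 hy
    have h4 := qhDist_triangle hΩ hfr (hg s hs).1 (hg t ht).1 hy
    linarith
  obtain ⟨g', hg'⟩ : ∃ g' : ℝ → Ω, ∀ t ∈ Icc 0 D, (g' t : CHat) = g t := by
    classical
    exact ⟨fun t => if ht : t ∈ Icc 0 D then ⟨g t, (hg t ht).1⟩ else ⟨x, hx⟩, fun t ht => by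
      simp only [dif_pos ht]⟩
  refine ⟨_, g', Subtype.ext ((hg' 0 h0D).trans hg0), Subtype.ext ((hg' D hDD).trans hgD), ?_, rfl⟩
  · intro s hs t ht
    replace hs : s ∈ Icc 0 D := hs
    replace ht : t ∈ Icc 0 D := ht
    simp only [hg' s hs, hg' t ht]
    refine le_antisymm (hgle s hs t ht) ?_
    rcases le_total s t with h | h
    · rw [abs_sub_comm, abs_of_nonneg (sub_nonneg.2 h)]; exact hge s hs t ht h
    · rw [abs_of_nonneg (sub_nonneg.2 h), qhDist_comm]
      exact hge t ht s hs h

/-! ### Gromov hyperbolicity and stability of quasigeodesics -/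

section Hyperbolic

variable {X Y : Type*}

/-- The axioms of a pseudometric for a real-valued distance function. -/
structure IsPseudoDist (d : X → X → ℝ) : Prop where
  self : ∀ x, d x x = 0
  comm : ∀ x y, d x y = d y x
  triangle : ∀ x y z, d x z ≤ d x y + d y z

theorem IsPseudoDist.nonneg {d : X → X → ℝ} (hd : IsPseudoDist d) (x y : X) : 0 ≤ d x y := by
  have h1 := hd.triangle x y x
  rw [hd.self, hd.comm y x] at h1
  linarith

theorem IsGeodesicSegment.symm {d : X → X → ℝ} (hd : IsPseudoDist d) {x y : X} {S : Set X}
    (h : IsGeodesicSegment d x y S) : IsGeodesicSegment d y x S := by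
  obtain ⟨γ, h0, h1, hγ, rfl⟩ := h
  have hmem : ∀ t, t ∈ Icc 0 (d x y) → d x y - t ∈ Icc 0 (d x y) := fun t ht =>
    ⟨by linarith [ht.2], by linarith [ht.1]⟩
  refine ⟨fun t => γ (d x y - t), by simp [h1], by simp [hd.comm y x, h0], ?_, ?_⟩
  · rw [hd.comm y x]
    intro s hs t ht
    rw [hγ _ (hmem s hs) _ (hmem t ht), sub_sub_sub_cancel_left, abs_sub_comm]
  · rw [hd.comm y x]
    ext p
    constructor
    · rintro ⟨t, ht, rfl⟩
      exact ⟨_, hmem t ht, by simp⟩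
    · rintro ⟨t, ht, rfl⟩
      exact ⟨_, hmem t ht, rfl⟩

theorem IsGeodesicSegment.dist_le {d : X → X → ℝ} {x y p : X} {S : Set X}
    (h : IsGeodesicSegment d x y S) (hp : p ∈ S) : d x p ≤ d x y := by
  obtain ⟨γ, h0, h1, hγ, rfl⟩ := h
  obtain ⟨t, ht, rfl⟩ := hp
  have := hγ 0 ⟨le_rfl, ht.1.trans ht.2⟩ t ht
  rw [h0, zero_sub, abs_neg, abs_of_nonneg ht.1] at this
  rw [this]
  exact ht.2

theorem isGeodesicSegment_image {d : X → X → ℝ} {γ : ℝ → X} {D s t : ℝ}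
    (hγ : ∀ s ∈ Icc 0 D, ∀ t ∈ Icc 0 D, d (γ s) (γ t) = |s - t|) (hs : 0 ≤ s) (hst : s ≤ t)
    (ht : t ≤ D) : IsGeodesicSegment d (γ s) (γ t) (γ '' Icc s t) := by
  have hd : d (γ s) (γ t) = t - s := by
    rw [hγ s ⟨hs, hst.trans ht⟩ t ⟨hs.trans hst, ht⟩, abs_sub_comm, abs_of_nonneg (sub_nonneg.2 hst)]
  refine ⟨fun r => γ (s + r), by simp, by simp [hd], ?_, ?_⟩
  · rw [hd]
    intro r hr r' hr'
    rw [hγ _ ⟨by linarith [hr.1], by linarith [hr.2]⟩ _ ⟨by linarith [hr'.1], by linarith [hr'.2]⟩,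
      add_sub_add_left_eq_sub]
  · rw [hd]
    ext p
    constructor
    · rintro ⟨r, hr, rfl⟩
      exact ⟨r - s, ⟨by linarith [hr.1], by linarith [hr.2]⟩, by simp⟩
    · rintro ⟨r, hr, rfl⟩
      exact ⟨s + r, ⟨by linarith [hr.1], by linarith [hr.2]⟩, rfl⟩

/-- In a hyperbolic space a geodesic is logarithmically close to every path with its endpoints. -/
theorem IsDeltaHyperbolic.exists_near_path {d : X → X → ℝ} (hd : IsPseudoDist d) {δ L : ℝ}
    (h : IsDeltaHyperbolic d δ) {c : ℝ → X} (N : ℕ) : ∀ {a b : ℝ}, a ≤ b → L * (b - a) ≤ 2 ^ N →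
      (∀ s ∈ Icc a b, ∀ t ∈ Icc a b, d (c s) (c t) ≤ L * |s - t|) → ∀ {S : Set X},
      IsGeodesicSegment d (c a) (c b) S → ∀ {x : X}, x ∈ S → ∃ t ∈ Icc a b, d x (c t) ≤ δ * N + 1 := by
  induction N with
  | zero =>
    intro a b hab hlen hc S hS x hx
    refine ⟨a, ⟨le_rfl, hab⟩, ?_⟩
    have h1 := hc a ⟨le_rfl, hab⟩ b ⟨hab, le_rfl⟩
    rw [abs_sub_comm, abs_of_nonneg (sub_nonneg.2 hab)] at h1
    rw [hd.comm]
    have h2 := hS.dist_le hx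
    norm_num at hlen ⊢
    linarith
  | succ N ih =>
    intro a b hab hlen hc S hS x hx
    have hm1 : a ≤ (a + b) / 2 := by linarith
    have hm2 : (a + b) / 2 ≤ b := by linarith
    -- Bisecting the parameter interval costs δ and halves the length bound. After N bisections it
    -- is at most 1, which accounts for the final summand 1.
    obtain ⟨S1, hS1⟩ := h.1 (c b) (c ((a + b) / 2))
    obtain ⟨S2, hS2⟩ := h.1 (c ((a + b) / 2)) (c a)
    obtain ⟨q, hq, hxq⟩ := h.2 _ _ _ _ _ _ hS hS1 hS2 x hx
    rw [pow_succ] at hlen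
    push_cast
    rcases hq with hq | hq
    · obtain ⟨t, ht, hqt⟩ := ih hm2 (by linarith)
        (fun s hs t ht => hc s (Icc_subset_Icc_left hm1 hs) t (Icc_subset_Icc_left hm1 ht)) (hS1.symm hd) hq
      exact ⟨t, Icc_subset_Icc_left hm1 ht, by linarith [hd.triangle x q (c t)]⟩
    · obtain ⟨t, ht, hqt⟩ := ih hm1 (by linarith)
        (fun s hs t ht => hc s (Icc_subset_Icc_right hm2 hs) t (Icc_subset_Icc_right hm2 ht)) (hS2.symm hd) hq
      exact ⟨t, Icc_subset_Icc_right hm2 ht, by linarith [hd.triangle x q (c t)]⟩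

/-- Suppose γ u is farther than R - 1 from the path. Go 2R along the geodesic to either side, or to
an endpoint, and join the points reached to path points within R. In the resulting quadrilateral γ u
is within 2δ of one of the other sides. The two connecting sides are too far away, so it is the side
between the path points. That side has length at most 6R, so the path between them has length at
most 6L²R, and the logarithmic estimate yields a path point within R - 1 after all. -/
theorem IsDeltaHyperbolic.improve_near_path {d : X → X → ℝ} (hd : IsPseudoDist d) {δ L T R : ℝ}
    (h : IsDeltaHyperbolic d δ) (hδ : 0 < δ) (hL : 0 < L) {c : ℝ → X} (hT : 0 ≤ T)
    (hc : ∀ s ∈ Icc 0 T, ∀ t ∈ Icc 0 T, d (c s) (c t) ≤ L * |s - t|)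
    (hc' : ∀ s ∈ Icc 0 T, ∀ t ∈ Icc 0 T, |s - t| ≤ L * d (c s) (c t)) {S : Set X}
    (hS : IsGeodesicSegment d (c 0) (c T) S) {N : ℕ} (hN : L * (L * (6 * R)) ≤ 2 ^ N)
    (hR : 2 * δ + 1 < R) (hNR : 2 * δ + (δ * N + 1) ≤ R - 1)
    (hP : ∀ x ∈ S, ∃ t ∈ Icc 0 T, d x (c t) ≤ R) : ∀ x ∈ S, ∃ t ∈ Icc 0 T, d x (c t) ≤ R - 1 := by
  obtain ⟨γ, h0, h1, hγ, rfl⟩ := hS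
  set D := d (c 0) (c T)
  rintro _ ⟨u, hu, rfl⟩
  by_contra! hcon
  have hnn := hd.nonneg
  -- a point of the path near a far point of the geodesic, or a common endpoint
  have hfar : ∀ v ∈ Icc 0 D, (|u - v| = 2 * R ∨ ((v = 0 ∨ v = D) ∧ |u - v| ≤ 2 * R)) →
      ∃ s ∈ Icc 0 T, d (γ v) (c s) ≤ R ∧ ∀ w, d (γ v) w ≤ d (γ v) (c s) → 2 * δ < d (γ u) w := by
    rintro v hv (huv | ⟨hv', -⟩)
    · obtain ⟨s, hs, hvs⟩ := hP (γ v) (mem_image_of_mem _ hv)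
      refine ⟨s, hs, hvs, fun w hw => ?_⟩
      have e1 := hγ u hu v hv
      have e2 := hd.triangle (γ u) w (γ v)
      rw [hd.comm w] at e2
      linarith
    · have hex : ∃ s ∈ Icc 0 T, γ v = c s := by
        rcases hv' with rfl | rfl
        · exact ⟨0, ⟨le_rfl, hT⟩, h0⟩
        · exact ⟨T, ⟨hT, le_rfl⟩, h1⟩
      obtain ⟨s, hs, hvs⟩ := hex
      refine ⟨s, hs, by rw [hvs, hd.self]; linarith, fun w hw => ?_⟩
      rw [hvs, hd.self] at hw
      have e1 := hcon s hs
      have e2 := hd.triangle (γ u) w (c s)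
      rw [hd.comm w] at e2
      linarith
  have hR0 : 0 < R := by linarith
  have hD0 : 0 ≤ D := hnn _ _
  set u1 := max 0 (u - 2 * R) with hu1
  set u2 := min D (u + 2 * R) with hu2
  have hu1u : u1 ≤ u := max_le hu.1 (by linarith)
  have huu2 : u ≤ u2 := le_min hu.2 (by linarith)
  have hu1I : u1 ∈ Icc 0 D := ⟨le_max_left _ _, hu1u.trans hu.2⟩
  have hu2I : u2 ∈ Icc 0 D := ⟨hu.1.trans huu2, min_le_left _ _⟩
  have hu1R : u - u1 ≤ 2 * R := by linarith [le_max_right 0 (u - 2 * R)]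
  have hu2R : u2 - u ≤ 2 * R := by linarith [min_le_right D (u + 2 * R)]
  obtain ⟨s1, hs1, hys, hyw⟩ := hfar u1 hu1I (by
    rw [abs_of_nonneg (sub_nonneg.2 hu1u)]
    rcases max_choice 0 (u - 2 * R) with h' | h'
    · exact Or.inr ⟨Or.inl h', hu1R⟩
    · left; rw [hu1, h']; ring)
  obtain ⟨s2, hs2, hzs, hzw⟩ := hfar u2 hu2I (by
    rw [abs_sub_comm, abs_of_nonneg (sub_nonneg.2 huu2)]
    rcases min_choice D (u + 2 * R) with h' | h'
    · exact Or.inr ⟨Or.inr h', hu2R⟩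
    · left; rw [hu2, h']; ring)
  have hyz := hγ u1 hu1I u2 hu2I
  rw [abs_sub_comm, abs_of_nonneg (by linarith)] at hyz
  have hA := isGeodesicSegment_image hγ hu1I.1 (hu1u.trans huu2) hu2I.2
  obtain ⟨B, hB⟩ := h.1 (γ u2) (c s2)
  obtain ⟨C, hC⟩ := h.1 (c s2) (γ u1)
  obtain ⟨B2, hB2⟩ := h.1 (γ u1) (c s1)
  obtain ⟨C2, hC2⟩ := h.1 (c s1) (c s2)
  obtain ⟨q1, hq1, hxq1⟩ := h.2 _ _ _ _ _ _ hA hB hC (γ u) ⟨u, ⟨hu1u, huu2⟩, rfl⟩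
  rcases hq1 with hq1 | hq1
  · linarith [hzw q1 (hB.dist_le hq1)]
  obtain ⟨q2, hq2, hxq2⟩ := h.2 _ _ _ _ _ _ hC hB2 hC2 q1 hq1
  have hxq := hd.triangle (γ u) q1 q2
  rcases hq2 with hq2 | hq2
  · linarith [hyw q2 (hB2.dist_le hq2)]
  -- R for each of the two connecting sides and 4R along the geodesic.
  have hcc : d (c s1) (c s2) ≤ 6 * R := by
    have e1 := hd.triangle (c s1) (γ u1) (c s2)
    have e2 := hd.triangle (γ u1) (γ u2) (c s2)
    rw [hd.comm (c s1) (γ u1)] at e1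
    linarith
  have hss : L * |s1 - s2| ≤ 2 ^ N := by
    refine le_trans ?_ hN
    gcongr
    exact (hc' s1 hs1 s2 hs2).trans (by gcongr)
  have hfin : ∃ t ∈ Icc 0 T, d q2 (c t) ≤ δ * N + 1 := by
    rcases le_total s1 s2 with hle | hle
    · rw [abs_sub_comm, abs_of_nonneg (sub_nonneg.2 hle)] at hss
      have hsub : Icc s1 s2 ⊆ Icc 0 T := Icc_subset_Icc hs1.1 hs2.2
      obtain ⟨t, ht, hqt⟩ := h.exists_near_path hd N hle hss
        (fun s hs t ht => hc s (hsub hs) t (hsub ht)) hC2 hq2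
      exact ⟨t, hsub ht, hqt⟩
    · rw [abs_of_nonneg (sub_nonneg.2 hle)] at hss
      have hsub : Icc s2 s1 ⊆ Icc 0 T := Icc_subset_Icc hs2.1 hs1.2
      obtain ⟨t, ht, hqt⟩ := h.exists_near_path hd N hle hss
        (fun s hs t ht => hc s (hsub hs) t (hsub ht)) (hC2.symm hd) hq2
      exact ⟨t, hsub ht, hqt⟩
  obtain ⟨t, ht, hqt⟩ := hfin
  linarith [hcon t ht, hd.triangle (γ u) q2 (c t)]

/-- For large R the admissible N grows linearly in R, so 2^N outgrows 6L²R. -/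
theorem exists_pow_two_bound {δ L : ℝ} (hδ : 0 < δ) : ∃ R₀ : ℝ, 0 ≤ R₀ ∧ ∀ R, R₀ ≤ R →
    2 * δ + 1 < R ∧ ∃ N : ℕ, L * (L * (6 * R)) ≤ 2 ^ N ∧ 2 * δ + (δ * N + 1) ≤ R - 1 := by
  have h1 := (tendsto_pow_const_div_const_pow_of_one_lt 1 (one_lt_two (α := ℝ))).const_mul (6 * L ^ 2 * δ)
  have h2 := (tendsto_pow_const_div_const_pow_of_one_lt 0 (one_lt_two (α := ℝ))).const_mul (6 * L ^ 2 * (3 * δ + 2))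
  have h3 := h1.add h2
  rw [mul_zero, mul_zero, add_zero] at h3
  obtain ⟨N₀, hN₀⟩ := eventually_atTop.1 (h3.eventually (gt_mem_nhds one_pos))
  refine ⟨δ * (N₀ + 1) + 2 + 2 * δ, by positivity, fun R hR => ⟨by nlinarith [N₀.cast_nonneg (α := ℝ)], ?_⟩⟩
  have hx : (N₀ + 1 : ℝ) ≤ (R - 2 - 2 * δ) / δ := by
    rw [le_div_iff₀ hδ]; linarith
  have hx0 : 0 ≤ (R - 2 - 2 * δ) / δ := le_trans (by positivity) hx
  set N := ⌊(R - 2 - 2 * δ) / δ⌋₊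
  have hN1 : (N : ℝ) ≤ (R - 2 - 2 * δ) / δ := Nat.floor_le hx0
  have hN2 : (R - 2 - 2 * δ) / δ < N + 1 := Nat.lt_floor_add_one _
  have hN3 : N₀ ≤ N := by
    have : (N₀ : ℝ) < N + 1 := by linarith
    exact_mod_cast Nat.lt_succ_iff.1 (by exact_mod_cast this)
  rw [le_div_iff₀ hδ] at hN1
  rw [div_lt_iff₀ hδ] at hN2
  refine ⟨N, ?_, by linarith⟩
  have h4 := hN₀ N hN3
  have hpow : (0 : ℝ) < 2 ^ N := by positivity
  rw [pow_one, pow_zero, mul_div_assoc', mul_div_assoc', ← add_div, div_lt_one hpow] at h4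
  have h5 : L ^ 2 * R ≤ L ^ 2 * (δ * N + 3 * δ + 2) :=
    mul_le_mul_of_nonneg_left (by linarith) (sq_nonneg L)
  nlinarith

/-- Stability of quasigeodesics, for bi-Lipschitz paths. -/
theorem exists_morse_constant {δ L : ℝ} (hδ : 0 < δ) (hL : 0 < L) : ∃ R : ℝ, 0 ≤ R ∧
    ∀ {X : Type*} {d : X → X → ℝ}, IsPseudoDist d → IsDeltaHyperbolic d δ →
      ∀ {c : ℝ → X} {T : ℝ}, 0 ≤ T →
      (∀ s ∈ Icc 0 T, ∀ t ∈ Icc 0 T, d (c s) (c t) ≤ L * |s - t|) →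
      (∀ s ∈ Icc 0 T, ∀ t ∈ Icc 0 T, |s - t| ≤ L * d (c s) (c t)) →
      ∀ {S : Set X}, IsGeodesicSegment d (c 0) (c T) S →
        (∀ x ∈ S, ∃ t ∈ Icc 0 T, d x (c t) ≤ R) ∧ ∀ t ∈ Icc 0 T, ∃ x ∈ S, d (c t) x ≤ R := by
  obtain ⟨R₀, hR₀, hbound⟩ := exists_pow_two_bound (L := L) hδ
  refine ⟨R₀ + L * (L * (2 * R₀ + 1)), by positivity, ?_⟩
  intro X d hd h c T hT hc hc' S hS
  -- Starting from the trivial radius d (c 0) (c T), the radius is lowered by 1 until it is at most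
  -- R₀. The number of rounds depends on the path, but R₀ does not.
  have hdesc : ∀ n : ℕ, ∀ R, R ≤ R₀ + n → (∀ x ∈ S, ∃ t ∈ Icc 0 T, d x (c t) ≤ R) →
      ∀ x ∈ S, ∃ t ∈ Icc 0 T, d x (c t) ≤ R₀ := by
    intro n
    induction n with
    | zero =>
      intro R hR hP x hx
      obtain ⟨t, ht, hxt⟩ := hP x hx
      exact ⟨t, ht, hxt.trans (by simpa using hR)⟩
    | succ n ih =>
      intro R hR hP
      push_cast at hR
      rcases le_total R R₀ with hle | hle
      · exact ih R (by linarith [n.cast_nonneg (α := ℝ)]) hP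
      · obtain ⟨h1, N, h2, h3⟩ := hbound R hle
        exact ih (R - 1) (by linarith) (h.improve_near_path hd hδ hL hT hc hc' hS h2 h1 h3 hP)
  have hP : ∀ x ∈ S, ∃ t ∈ Icc 0 T, d x (c t) ≤ R₀ := by
    obtain ⟨n, hn⟩ := exists_nat_ge (d (c 0) (c T))
    refine hdesc n (d (c 0) (c T)) (by linarith) fun x hx => ⟨0, ⟨le_rfl, hT⟩, ?_⟩
    rw [hd.comm]
    exact hS.dist_le hx
  have hpos : 0 ≤ L * (L * (2 * R₀ + 1)) := by positivity
  refine ⟨fun x hx => ?_, fun τ hτ => ?_⟩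
  · obtain ⟨t, ht, hxt⟩ := hP x hx
    exact ⟨t, ht, by linarith⟩
  obtain ⟨γ, h0, h1, hγ, rfl⟩ := hS
  set D := d (c 0) (c T)
  have hD0 : 0 ≤ D := hd.nonneg _ _
  -- A consists of the geodesic parameters with a path point near them before time τ. A step of
  -- length at most 1 from near its supremum reaches a geodesic point with a path point near it at a
  -- time after τ. The two path points are within 2R₀ + 1 of each other, so τ lies in a short time
  -- interval; no continuity argument is needed.
  set A : Set ℝ := {r | r ∈ Icc 0 D ∧ ∃ s ∈ Icc 0 τ, d (γ r) (c s) ≤ R₀} with hA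
  have h0A : (0 : ℝ) ∈ A := ⟨⟨le_rfl, hD0⟩, 0, ⟨le_rfl, hτ.1⟩, by rw [h0, hd.self]; exact hR₀⟩
  have hAb : BddAbove A := ⟨D, fun r hr => hr.1.2⟩
  obtain ⟨r, hrA, hr⟩ := exists_lt_of_lt_csSup ⟨0, h0A⟩ (sub_lt_self (sSup A) (one_half_pos (α := ℝ)))
  obtain ⟨hrD, s, hs, hrs⟩ := hrA
  obtain ⟨r', hr', hrr', t, ht, hrt⟩ : ∃ r' ∈ Icc 0 D, |r - r'| ≤ 1 ∧ ∃ t ∈ Icc τ T, d (γ r') (c t) ≤ R₀ := by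
    rcases le_total D (r + 1) with hle | hle
    · refine ⟨D, ⟨hD0, le_rfl⟩, ?_, T, ⟨hτ.2, le_rfl⟩, by rw [h1, hd.self]; exact hR₀⟩
      rw [abs_sub_comm, abs_of_nonneg (sub_nonneg.2 hrD.2)]
      linarith
    · have hmem : r + 1 ∈ Icc 0 D := ⟨by linarith [hrD.1], hle⟩
      obtain ⟨t, ht, hrt⟩ := hP _ (mem_image_of_mem γ hmem)
      refine ⟨r + 1, hmem, by simp, t, ⟨?_, ht.2⟩, hrt⟩
      by_contra hlt
      have : r + 1 ≤ sSup A := le_csSup hAb ⟨hmem, t, ⟨ht.1, (not_le.1 hlt).le⟩, hrt⟩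
      linarith
  have hs' : s ∈ Icc 0 T := ⟨hs.1, hs.2.trans hτ.2⟩
  have ht' : t ∈ Icc 0 T := ⟨hτ.1.trans ht.1, ht.2⟩
  have e1 := hd.triangle (c s) (γ r) (c t)
  have e2 := hd.triangle (γ r) (γ r') (c t)
  rw [hd.comm (c s) (γ r)] at e1
  rw [hγ r hrD r' hr'] at e2
  have e3 : d (c s) (c t) ≤ 2 * R₀ + 1 := by linarith
  have e4 : t - s ≤ L * (2 * R₀ + 1) := by
    have := hc' s hs' t ht'
    rw [abs_sub_comm, abs_of_nonneg (by linarith [hs.2, ht.1])] at this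
    exact this.trans (by gcongr)
  have e5 : d (c τ) (c s) ≤ L * (L * (2 * R₀ + 1)) := by
    refine (hc τ hτ s hs').trans ?_
    rw [abs_of_nonneg (sub_nonneg.2 hs.2)]
    have := ht.1
    gcongr
    linarith
  refine ⟨γ r, mem_image_of_mem _ hrD, ?_⟩
  have e6 := hd.triangle (c τ) (c s) (γ r)
  rw [hd.comm (c s) (γ r)] at e6
  linarith

/-- Hyperbolicity of geodesic spaces is invariant under bi-Lipschitz bijections, quantitatively. -/
theorem exists_hyperbolicity_constant {δ L : ℝ} (hδ : 0 < δ) (hL : 0 < L) : ∃ δ' : ℝ, 0 < δ' ∧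
    ∀ {X Y : Type*} {dX : X → X → ℝ} {dY : Y → Y → ℝ}, IsPseudoDist dX →
      IsDeltaHyperbolic dX δ → (∀ x y : Y, ∃ S, IsGeodesicSegment dY x y S) → IsPseudoDist dY →
      ∀ {G : Y → X}, (∀ x y, dX (G x) (G y) ≤ L * dY x y) → (∀ x y, dY x y ≤ L * dX (G x) (G y)) →
      IsDeltaHyperbolic dY δ' := by
  obtain ⟨R, hR0, hR⟩ := exists_morse_constant hδ hL
  -- From a side in Y to the matching geodesic in X (R), to another side of that triangle (δ), and
  -- back to the image of a side in Y (R); the factor L converts the distance in X to one in Y.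
  refine ⟨L * (R + δ + R), by positivity, ?_⟩
  intro X Y dX dY hX hyp hgeo hY G hG1 hG2
  refine ⟨hgeo, fun x y z A B C hA hB hC p hp => ?_⟩
  obtain ⟨SA, hSA⟩ := hyp.1 (G x) (G y)
  obtain ⟨SB, hSB⟩ := hyp.1 (G y) (G z)
  obtain ⟨SC, hSC⟩ := hyp.1 (G z) (G x)
  have key : ∀ {x y : Y} {A : Set Y} {S : Set X}, IsGeodesicSegment dY x y A →
      IsGeodesicSegment dX (G x) (G y) S →
      (∀ v ∈ S, ∃ q ∈ A, dX v (G q) ≤ R) ∧ ∀ q ∈ A, ∃ v ∈ S, dX (G q) v ≤ R := by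
    intro x y A S hA hS
    obtain ⟨γ, h0, h1, hγ, rfl⟩ := hA
    obtain ⟨k1, k2⟩ := hR hX hyp (c := fun t => G (γ t)) (T := dY x y) (hY.nonneg x y)
      (fun s hs t ht => by rw [← hγ s hs t ht]; exact hG1 _ _)
      (fun s hs t ht => by rw [← hγ s hs t ht]; exact hG2 _ _) (S := S) (by simpa only [h0, h1] using hS)
    refine ⟨fun v hv => ?_, ?_⟩
    · obtain ⟨t, ht, hvt⟩ := k1 v hv
      exact ⟨γ t, mem_image_of_mem _ ht, hvt⟩
    · rintro _ ⟨t, ht, rfl⟩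
      exact k2 t ht
  obtain ⟨v1, hv1, hpv⟩ := (key hA hSA).2 p hp
  obtain ⟨v2, hv2, hvv⟩ := hyp.2 _ _ _ _ _ _ hSA hSB hSC v1 hv1
  have hfin : ∃ q ∈ B ∪ C, dX v2 (G q) ≤ R := by
    rcases hv2 with hv2 | hv2
    · obtain ⟨q, hq, hvq⟩ := (key hB hSB).1 v2 hv2
      exact ⟨q, Or.inl hq, hvq⟩
    · obtain ⟨q, hq, hvq⟩ := (key hC hSC).1 v2 hv2
      exact ⟨q, Or.inr hq, hvq⟩
  obtain ⟨q, hq, hvq⟩ := hfin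
  refine ⟨q, hq, (hG2 p q).trans (mul_le_mul_of_nonneg_left ?_ hL.le)⟩
  linarith [hX.triangle (G p) v1 (G q), hX.triangle v1 v2 (G q)]

end Hyperbolic

/-! ### Transfer of hyperbolicity between domains and the theorem -/

theorem isPseudoDist_qhDist {Ω : Set CHat} (hΩ : IsDomainOfSphere Ω) (hfr : (frontier Ω).Nonempty) :
    IsPseudoDist (fun x y : Ω => qhDist Ω x y) :=
  ⟨fun x => qhDist_self x.2, fun x y => qhDist_comm Ω x y,
    fun x y z => qhDist_triangle hΩ hfr x.2 y.2 z.2⟩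

theorem frontier_nonempty_of_sphericalDiam {a : ℝ} (ha : 0 < a) {Ω : Set CHat}
    (hΩ : IsDomainOfSphere Ω) (h : ENNReal.ofReal a ≤ sphericalDiam Ωᶜ) : (frontier Ω).Nonempty := by
  obtain ⟨p, hp, -⟩ := exists_chordal_ge ha h
  exact frontier_nonempty hΩ.2 ⟨p, hp⟩

/-- A bi-Lipschitz bijection of domains transfers hyperbolicity. -/
theorem exists_hyperbolic_domain_constant {δ L : ℝ} (hδ : 0 < δ) (hL : 0 < L) :
    ∃ δ' : ℝ, 0 < δ' ∧ ∀ {U V : Set CHat} {f : CHat → CHat}, IsDomainOfSphere U → IsDomainOfSphere V →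
      (frontier U).Nonempty → (frontier V).Nonempty → BijOn f U V →
      IsBiLipschitzOn L (qhDist U) (qhDist V) f U → IsHyperbolicDomain U δ → IsHyperbolicDomain V δ' := by
  obtain ⟨δ', hδ', h⟩ := exists_hyperbolicity_constant hδ hL
  refine ⟨δ', hδ', fun {U V f} hU hV hUf hVf hf hlip hyp => ?_⟩
  have hg : MapsTo (Function.invFunOn f U) V U := hf.surjOn.mapsTo_invFunOn
  have hfg : ∀ q ∈ V, f (Function.invFunOn f U q) = q := fun q hq => hf.surjOn.rightInvOn_invFunOn hq
  -- The comparison map goes from V to U, since geodesics of V are to be compared with those of the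
  -- hyperbolic domain U. Geodesics in V exist independently of f.
  refine h (isPseudoDist_qhDist hU hUf) hyp (exists_geodesic hV hVf) (isPseudoDist_qhDist hV hVf)
    (G := fun q => ⟨Function.invFunOn f U q, hg q.2⟩) (fun x y => ?_) (fun x y => ?_)
  · have := (hlip _ (hg x.2) _ (hg y.2)).1
    rwa [hfg _ x.2, hfg _ y.2, inv_mul_le_iff₀ hL] at this
  · have := (hlip _ (hg x.2) _ (hg y.2)).2
    rwa [hfg _ x.2, hfg _ y.2] at this

end SphericalQH

end

theorem theorem4p1 (a : ℝ) (ha : 0 < a) :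
    (∃ L : ℝ, 1 ≤ L ∧
      ∀ (U V : Set SphericalQH.CHat) (f : SphericalQH.CHat → SphericalQH.CHat),
        SphericalQH.IsDomainOfSphere U → SphericalQH.IsDomainOfSphere V →
        ENNReal.ofReal a ≤ SphericalQH.sphericalDiam Uᶜ →
        ENNReal.ofReal a ≤ SphericalQH.sphericalDiam Vᶜ →
        SphericalQH.IsConformalMap f U V →
        SphericalQH.IsBiLipschitzOn L (SphericalQH.qhDist U) (SphericalQH.qhDist V) f U) ∧
    (∀ δ : ℝ, 0 < δ → ∃ δ' : ℝ, 0 < δ' ∧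
      ∀ (U V : Set SphericalQH.CHat) (f : SphericalQH.CHat → SphericalQH.CHat),
        SphericalQH.IsDomainOfSphere U → SphericalQH.IsDomainOfSphere V →
        ENNReal.ofReal a ≤ SphericalQH.sphericalDiam Uᶜ →
        ENNReal.ofReal a ≤ SphericalQH.sphericalDiam Vᶜ →
        SphericalQH.IsConformalMap f U V →
        SphericalQH.IsHyperbolicDomain U δ → SphericalQH.IsHyperbolicDomain V δ') := by
  set L : ℝ := max 1 (16 * (384 / (a / 32) ^ 2)) with hL
  have hL1 : 1 ≤ L := le_max_left _ _
  refine ⟨⟨L, hL1, fun U V f hU hV hUa hVa hf =>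
    hf.isBiLipschitzOn ha hU hV hUa hVa (le_max_right _ _)⟩, fun δ hδ => ?_⟩
  obtain ⟨δ', hδ', h⟩ :=
    SphericalQH.exists_hyperbolic_domain_constant hδ (L := L) (by linarith)
  exact ⟨δ', hδ', fun U V f hU hV hUa hVa hf =>
    h hU hV (SphericalQH.frontier_nonempty_of_sphericalDiam ha hU hUa)
      (SphericalQH.frontier_nonempty_of_sphericalDiam ha hV hVa) hf.1
      (hf.isBiLipschitzOn ha hU hV hUa hVa (le_max_right _ _))⟩
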